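/- Let $G$ be a (real, finite-dimensional) Lie group acting smoothly on a (finite-dimensional, Hausdorff, second countable) smooth manifold $X$ without boundary. Write $O_x$ for the orbit of $x\in X$, with tangent space $T_xO_x\subset T_xX$ equal to the image of $\mathrm{Lie}(G)$ under the differential at the identity of $g\mapsto g\cdot x$. Vector fields and diffeomorphisms are of class $C^\infty$, and a diffeomorphism of $X$ is called orbit-preserving if it maps every $G$-orbit onto itself. **(I) Isotopy lemma for Lie group actions.** Let $Y\subset X$ be a $G$-invariant subset with compact closure, let $f:X\to\mathbb R$ be smooth, and let $[a,b]\subset\mathbb R$ be such that for every $c\in[a,b]$ the level set $f^{-1}(c)$ is transverse to every orbit contained in $\overline Y$; that is, at each point $x\in\overline Y$ with $f(x)=c$ one has $df_x\neq 0$ and $\ker df_x+T_xO_x=T_xX$. Then there is a vector field $v$ on $X$ with compact support such that $v(y)\in T_yO_y$ for every $y\in Y$, and $L_vf(y)=1$ for every $y\in Y$ with $f(y)\in[a,b]$. Moreover, for all $c_1,c_2\in[a,b]$ there is an orbit-preserving diffeomorphism of $X$ that maps $f^{-1}(c_1)\cap Y$ onto $f^{-1}(c_2)\cap Y$. **(II)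 Main theorem.** Suppose that $X$ is compact, let $k\ge 0$, and let $F:X\times\mathbb R^k\to X$ be a smooth map such that $F_z=F(\cdot,z):X\to X$ is a diffeomorphism for every $z\in\mathbb R^k$. Let $M\subset X$ be a compact embedded submanifold (without boundary) of codimension $k$, let $Y\subset X$ be a closed $G$-invariant subset, and let $D=[a_1,b_1]\times\dots\times[a_k,b_k]\subset\mathbb R^k$. Assume that for all $z\in D$ and $y\in Y$ the submanifold $F_z(M)$ is transverse to $O_y$, i.e. $T_xF_z(M)+T_xO_y=T_xX$ for all $x\in F_z(M)\cap O_y$. Put $\widehat M=\{(F(x,z),z): x\in M,\ z\in\mathbb R^k\}\subset X\times\mathbb R^k$ and $t_j(x,z)=z_j$. Then there exist vector fields $v_1,\dots,v_k$ on $X\times\mathbb R^k$ such that 1. each $v_i$ has compact support; 2. $v_i(x,z)\in T_{(x,z)}\widehat M$ for all $(x,z)\in\widehat M$; 3. $v_i(x,z)\in T_xO_x\times\mathbb R^k$ for all $(x,z)\in X\times D$; 4. $L_{v_i}t_j(x,z)=\delta_{ij}$ for all $(x,z)\in\widehat M\cap(Y\times D)$. Consequently all the sections $F_z(M)\cap Y$,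 $z\in D$, are diffeomorphic by orbit-preserving diffeomorphisms: for all $z,z'\in D$ there is an orbit-preserving diffeomorphism of $X$ that maps $F_z(M)\cap Y$ onto $F_{z'}(M)\cap Y$. -/

import Mathlib

open scoped Manifold ContDiff

noncomputable section

/-- `IsSubmanifoldOfCodim k M`: the subset `M` of the manifold `X` (modelled on `E`, without
boundary) is an embedded smooth submanifold of codimension `k`. Around each of its points there is
a smooth chart of `X` that carries `M` to a linear subspace of `E` of codimension `k`. -/
def IsSubmanifoldOfCodim {E : Type*} [NormedAddCommGroup E] [NormedSpace ℝ E]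
    {X : Type*} [TopologicalSpace X] [ChartedSpace E X] (k : ℕ) (M : Set X) : Prop :=
  ∀ p ∈ M, ∃ φ ∈ IsManifold.maximalAtlas 𝓘(ℝ, E) ∞ X, p ∈ φ.source ∧
    ∃ S : Submodule ℝ E, Module.finrank ℝ S + k = Module.finrank ℝ E ∧
      ∀ q ∈ φ.source, q ∈ M ↔ φ q ∈ S

/-- The set of tangent vectors at `p` to a subset `S` of a manifold: the velocities at time `0` of
smooth curves in `S` through `p`. If `S` is an embedded submanifold and `p ∈ S`, this is the
tangent space `T_p S`. The equation in the tangent bundle says that `γ 0 = p` and `γ' 0 = u`. -/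
def tangentVectors {E H : Type*} [NormedAddCommGroup E] [NormedSpace ℝ E] [TopologicalSpace H]
    (I : ModelWithCorners ℝ E H) {X : Type*} [TopologicalSpace X] [ChartedSpace H X]
    (S : Set X) (p : X) : Set (TangentSpace I p) :=
  {u | ∃ γ : ℝ → X, ContMDiffAt 𝓘(ℝ, ℝ) I ∞ γ 0 ∧ (∀ᶠ t in nhds (0 : ℝ), γ t ∈ S) ∧
    (⟨γ 0, mfderiv 𝓘(ℝ, ℝ) I γ 0 (1 : ℝ)⟩ : TangentBundle I X) = ⟨p, u⟩}

/-- The tangent space `T_x O_x` of the orbit of `x` under a smooth action of a Lie group `G`: the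
image of the Lie algebra `T_1 G` under the differential at `1` of the orbit map `g ↦ g • x`.
The equation in the tangent bundle only accounts for `1 • x = x`. -/
def orbitTangent {E E' : Type*} [NormedAddCommGroup E] [NormedSpace ℝ E]
    [NormedAddCommGroup E'] [NormedSpace ℝ E']
    (G : Type*) [TopologicalSpace G] [ChartedSpace E' G] [Group G]
    {X : Type*} [TopologicalSpace X] [ChartedSpace E X] [MulAction G X] (x : X) :
    Set (TangentSpace 𝓘(ℝ, E) x) :=
  {u | ∃ ξ : TangentSpace 𝓘(ℝ, E') (1 : G),
    (⟨(1 : G) • x, mfderiv 𝓘(ℝ, E') 𝓘(ℝ, E) (fun g : G => g • x) 1 ξ⟩ :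
      TangentBundle 𝓘(ℝ, E) X) = ⟨x, u⟩}

/-- The submanifold `N` is transverse to the orbit of `y`: `T_x N + T_x O_y = T_x X` at each point
`x` of their intersection (where `O_y = O_x`). -/
def TransverseToOrbit {E E' : Type*} [NormedAddCommGroup E] [NormedSpace ℝ E]
    [NormedAddCommGroup E'] [NormedSpace ℝ E']
    (G : Type*) [TopologicalSpace G] [ChartedSpace E' G] [Group G]
    {X : Type*} [TopologicalSpace X] [ChartedSpace E X] [MulAction G X]
    (N : Set X) (y : X) : Prop :=
  ∀ x ∈ N ∩ MulAction.orbit G y, ∀ w : TangentSpace 𝓘(ℝ, E) x,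
    ∃ u ∈ tangentVectors 𝓘(ℝ, E) N x, ∃ ξ ∈ orbitTangent (E' := E') G x, u + ξ = w

/-- The level set of `f` at height `c` is transverse to the orbit of `y`: at each point `x` of their
intersection the level set is regular (`df_x ≠ 0`, so that it is near `x` a hypersurface with
tangent space `ker df_x`) and `ker df_x + T_x O_y = T_x X`. -/
def LevelSetTransverseToOrbit {E E' : Type*} [NormedAddCommGroup E] [NormedSpace ℝ E]
    [NormedAddCommGroup E'] [NormedSpace ℝ E']
    (G : Type*) [TopologicalSpace G] [ChartedSpace E' G] [Group G]
    {X : Type*} [TopologicalSpace X] [ChartedSpace E X] [MulAction G X]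
    (f : X → ℝ) (c : ℝ) (y : X) : Prop :=
  ∀ x ∈ f ⁻¹' {c} ∩ MulAction.orbit G y, mfderiv 𝓘(ℝ, E) 𝓘(ℝ, ℝ) f x ≠ 0 ∧
    ∀ w : TangentSpace 𝓘(ℝ, E) x, ∃ u : TangentSpace 𝓘(ℝ, E) x,
      mfderiv 𝓘(ℝ, E) 𝓘(ℝ, ℝ) f x u = 0 ∧ ∃ ξ ∈ orbitTangent (E' := E') G x, u + ξ = w

/-- `v` is a smooth vector field, that is, a smooth section of the tangent bundle. -/
def IsSmoothVectorField {E H : Type*} [NormedAddCommGroup E] [NormedSpace ℝ E]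
    [TopologicalSpace H] (I : ModelWithCorners ℝ E H) {X : Type*} [TopologicalSpace X]
    [ChartedSpace H X] [IsManifold I ∞ X] (v : ∀ x : X, TangentSpace I x) : Prop :=
  ContMDiff I I.tangent ∞ (fun x => (⟨x, v x⟩ : TangentBundle I X))

/-- The vector field `v` has compact support. -/
def HasCompactSupportField {E H : Type*} [NormedAddCommGroup E] [NormedSpace ℝ E]
    [TopologicalSpace H] (I : ModelWithCorners ℝ E H) {X : Type*} [TopologicalSpace X]
    [ChartedSpace H X] (v : ∀ x : X, TangentSpace I x) : Prop :=
  IsCompact (closure {x | v x ≠ 0})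

/-- The Lie derivative `L_v f = df(v)` of a function along a vector field. -/
def lieDerivFun {E H : Type*} [NormedAddCommGroup E] [NormedSpace ℝ E]
    [TopologicalSpace H] (I : ModelWithCorners ℝ E H) {X : Type*} [TopologicalSpace X]
    [ChartedSpace H X] (v : ∀ x : X, TangentSpace I x) (f : X → ℝ) (x : X) : ℝ :=
  mfderiv I 𝓘(ℝ, ℝ) f x (v x)

/-- A diffeomorphism of `X` that maps every orbit of `G` to itself. -/
def OrbitPreserving {E : Type*} [NormedAddCommGroup E] [NormedSpace ℝ E]
    (G : Type*) [Group G] {X : Type*} [TopologicalSpace X] [ChartedSpace E X] [MulAction G X]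
    (Φ : X ≃ₘ^∞⟮𝓘(ℝ, E), 𝓘(ℝ, E)⟯ X) : Prop :=
  ∀ y : X, Φ '' MulAction.orbit G y = MulAction.orbit G y

/-- The member `F_z(M)` of the family of subsets given by `F`. -/
def familyMember {X : Type*} {k : ℕ} (F : X × (Fin k → ℝ) → X) (M : Set X) (z : Fin k → ℝ) :
    Set X :=
  (fun x => F (x, z)) '' M

/-- The total space `{(F(x, z), z) : x ∈ M, z ∈ ℝ^k}` of the family. -/
def familyTotal {X : Type*} {k : ℕ} (F : X × (Fin k → ℝ) → X) (M : Set X) :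
    Set (X × (Fin k → ℝ)) :=
  (fun p => (F p, p.2)) '' (M ×ˢ Set.univ)

end

/-!
All diffeomorphisms are built in the form `x ↦ γ(u(x, z)) • x`, where `γ : Lie(G) → G` is a smooth
map with `γ(0) = 1` and bijective derivative at `0`, and `u` is a smooth `Lie(G)`-valued function
with compact support that vanishes for `z = z₀`. Such maps carry each orbit into itself for trivial
reasons, and the inverse function theorem shows that they are diffeomorphisms of `X` for all `z`
close to `z₀` (`eventually_exists_diffeomorph`). No flow of a vector field is needed.

Both assertions on diffeomorphisms concern a family `N z` of subsets of `X`, level sets of `f` or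
members `F_z(M)`. Near a point of `N z₀` in the closure of `Y` the family is given by an equation
`Q(x, z) = 0` for which
the derivative of `w ↦ Q(γ(w) • x, z₀)` is surjective; this is what transversality to the orbits
means (`IsTransverseDefiningFunction`). The implicit function theorem then solves the equation
`Q(γ(w + Pc) • x, z) = Q(x, z₀)` for `c`, where `P` embeds the target of `Q` into `Lie(G)` as a
complement of the kernel of that derivative (`IsTransverseDefiningFunction.exists_correction`). By
local uniqueness `c = 0` whenever `w` carries `x ∈ N z₀` into `N z` already. Hence finitely many
local corrections, cut off and added one after the other, do not disturb each other, and they yield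
one global `u` (`exists_compactDeformation_of_local_correction`). The resulting diffeomorphism
carries `N z₀ ∩ Y` into `N z ∩ Y`, and it carries no other point of `Y` there
(`IsTransverseDefiningFunction.eventually_mem_of_deformation`). So parameters close to each other
are related by an orbit-preserving diffeomorphism, and as the set of parameters is connected, all of
them are.

The vector fields are sections `p ↦ d/dt|₀ γ(t φ(p)) • p` with a smooth `Lie(G)`-valued function
`φ`, and similarly on `X × ℝᵏ` (`motionField`). The required properties are convex conditions on
the values of `φ`, so that local solutions, which linear algebra provides, are glued by a partition
of unity (`exists_vectorField_levelSets`, `exists_vectorField_family`). To see that tangency to the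
total space of the family is a linear condition, the set of velocities of curves in it is identified
with the kernel of the derivative of a local defining function
(`exists_definingFunction_familyTotal`).
-/

open Filter Topology Set

/-! ### The inverse and implicit function theorems on manifolds -/

section InverseFunction

variable {E : Type*} [NormedAddCommGroup E] [NormedSpace ℝ E] [CompleteSpace E]
  {F : Type*} [NormedAddCommGroup F] [NormedSpace ℝ F] [CompleteSpace F]
  {H : Type*} [TopologicalSpace H] {I : ModelWithCorners ℝ E H} [I.Boundaryless]
  {H' : Type*} [TopologicalSpace H'] {J : ModelWithCorners ℝ F H'} [J.Boundaryless]
  {M : Type*} [TopologicalSpace M] [ChartedSpace H M] [IsManifold I ∞ M]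
  {N : Type*} [TopologicalSpace N] [ChartedSpace H' N] [IsManifold J ∞ N]

/-- **Inverse function theorem** on manifolds without boundary. -/
theorem isLocalDiffeomorphAt_of_bijective_mfderiv {f : M → N} {p : M}
    (hf : ∀ᶠ x in 𝓝 p, ContMDiffAt I J ∞ f x)
    (hb : Function.Bijective (mfderiv I J f p)) : IsLocalDiffeomorphAt I J ∞ f p := by
  set φ := extChartAt I p with hφ
  set ψ := extChartAt J (f p) with hψ
  set g : E → F := ψ ∘ f ∘ φ.symm with hg
  have hfp : ContMDiffAt I J ∞ f p := hf.self_of_nhds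
  have hsymm : Tendsto φ.symm (𝓝 (φ p)) (𝓝 p) := by
    have := continuousAt_extChartAt_symm (I := I) p
    rwa [ContinuousAt, extChartAt_to_inv] at this
  have hφt : ∀ᶠ y in 𝓝 (φ p), y ∈ φ.target := extChartAt_target_mem_nhds p
  have hψs : ∀ᶠ x in 𝓝 p, f x ∈ ψ.source :=
    hfp.continuousAt.eventually (extChartAt_source_mem_nhds (f p))
  have hgood : ∀ᶠ y in 𝓝 (φ p), ContDiffAt ℝ ∞ g y := by
    filter_upwards [hφt, hsymm.eventually hf, hsymm.eventually hψs] with y hy hfy hys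
    refine ContMDiffAt.contDiffAt ?_
    refine ContMDiffAt.comp (I' := J) y (g := ψ) ?_ (ContMDiffAt.comp (I' := I) y hfy ?_)
    · exact contMDiffAt_extChartAt' (by rwa [← extChartAt_source J])
    · exact (contMDiffOn_extChartAt_symm p).contMDiffAt (extChartAt_target_mem_nhds' hy)
  have hgp : ContDiffAt ℝ ∞ g (φ p) := hgood.self_of_nhds
  have hder : mfderiv I J f p = fderiv ℝ g (φ p) := by
    rw [(hfp.mdifferentiableAt (by simp)).mfderiv, I.range_eq_univ, fderivWithin_univ]
    rfl
  let f' : E ≃L[ℝ] F := ContinuousLinearEquiv.ofBijective (fderiv ℝ g (φ p))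
    (LinearMap.ker_eq_bot.2 (hder ▸ hb).1) (LinearMap.range_eq_top.2 (hder ▸ hb).2)
  have hf' : HasFDerivAt g (f' : E →L[ℝ] F) (φ p) :=
    (hgp.differentiableAt (by simp)).hasFDerivAt
  let e := hgp.toOpenPartialHomeomorph g hf' (by simp)
  have hinv : ∀ᶠ y in 𝓝 (φ p), fderiv ℝ g y ∈ range ((↑) : (E ≃L[ℝ] F) → E →L[ℝ] F) :=
    (hgp.continuousAt_fderiv (by simp)).eventually (ContinuousLinearEquiv.nhds f')
  obtain ⟨U, hU, hUo, hpU⟩ := eventually_nhds_iff.1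
    (hgood.and (hinv.and ((hsymm.eventually hf).and (hsymm.eventually hψs))))
  let A := (chartAt H p).trans I.toHomeomorph.toOpenPartialHomeomorph
  let B := (chartAt H' (f p)).trans J.toHomeomorph.toOpenPartialHomeomorph
  let e' := e.restrOpen U hUo
  let T := A.trans (e'.trans B.symm)
  have hTs : ∀ x ∈ T.source, x ∈ φ.source ∧ φ x ∈ e.source ∧ φ x ∈ U := by
    intro x hx
    have h1 : x ∈ (chartAt H p).source := by simpa [A] using hx.1
    have h2 : φ x ∈ e'.source := hx.2.1
    exact ⟨by rwa [hφ, extChartAt_source], h2.1, h2.2⟩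
  have hTf : ∀ x ∈ T.source, f x = T x := by
    intro x hx
    obtain ⟨h1, h2, h3⟩ := hTs x hx
    have h4 := (hU _ h3).2.2.2
    rw [φ.left_inv h1] at h4
    change f x = ψ.symm (ψ (f (φ.symm (φ x))))
    rw [φ.left_inv h1, ψ.left_inv h4]
  have hps : p ∈ T.source := by
    have h3 : e (φ p) = ψ (f p) := congrArg (fun x => ψ (f x)) (extChartAt_to_inv p)
    refine ⟨by simp [A], ⟨⟨hgp.mem_toOpenPartialHomeomorph_source hf' (by simp), hpU⟩, ?_⟩⟩
    change e (φ p) ∈ B.target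
    rw [h3]
    exact B.map_source (by simp [B])
  refine ⟨⟨T.toPartialEquiv, T.open_source, T.open_target, ?_, ?_⟩, hps, hTf⟩
  · intro x hx
    have h := (hU _ (hTs x hx).2.2).2.2.1
    rw [φ.left_inv (hTs x hx).1] at h
    exact h.contMDiffWithinAt.congr (fun y hy => (hTf y hy).symm) (hTf x hx).symm
  · intro y hy
    have h1 : y ∈ (chartAt H' (f p)).source := by
      have := hy.1.1
      simpa [B] using this
    have h2 : B y ∈ e'.target := hy.1.2
    have h3 : e'.symm (B y) ∈ A.target := hy.2
    have h4 := e'.map_target h2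
    obtain ⟨d, hd⟩ := (hU _ h4.2).2.1
    have h5 : ContDiffAt ℝ ∞ e'.symm (B y) := by
      refine e'.contDiffAt_symm h2 (f₀' := d) ?_ (hU _ h4.2).1
      rw [hd]
      exact ((hU _ h4.2).1.differentiableAt (by simp)).hasFDerivAt
    have h6 : ContMDiffAt 𝓘(ℝ, E) I ∞ φ.symm (e'.symm (B y)) := by
      refine (contMDiffOn_extChartAt_symm p).contMDiffAt (extChartAt_target_mem_nhds' ?_)
      rw [extChartAt_target, I.range_eq_univ]
      simpa [A] using h3
    have h7 : ContMDiffAt J 𝓘(ℝ, F) ∞ B y := contMDiffAt_extChartAt' (I := J) h1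
    exact (h6.comp y (h5.contMDiffAt.comp y h7)).contMDiffWithinAt

end InverseFunction

section FibredMaps

variable {E₁ : Type*} [NormedAddCommGroup E₁] [NormedSpace ℝ E₁] [CompleteSpace E₁]
  {E₂ : Type*} [NormedAddCommGroup E₂] [NormedSpace ℝ E₂] [CompleteSpace E₂]
  {E₃ : Type*} [NormedAddCommGroup E₃] [NormedSpace ℝ E₃] [CompleteSpace E₃]
  {H₁ : Type*} [TopologicalSpace H₁] {I₁ : ModelWithCorners ℝ E₁ H₁} [I₁.Boundaryless]
  {H₂ : Type*} [TopologicalSpace H₂] {I₂ : ModelWithCorners ℝ E₂ H₂} [I₂.Boundaryless]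
  {H₃ : Type*} [TopologicalSpace H₃] {I₃ : ModelWithCorners ℝ E₃ H₃} [I₃.Boundaryless]
  {M : Type*} [TopologicalSpace M] [ChartedSpace H₁ M] [IsManifold I₁ ∞ M]
  {P : Type*} [TopologicalSpace P] [ChartedSpace H₂ P] [IsManifold I₂ ∞ P]
  {N : Type*} [TopologicalSpace N] [ChartedSpace H₃ N] [IsManifold I₃ ∞ N]

omit [CompleteSpace E₁] [CompleteSpace E₂] [CompleteSpace E₃] [I₁.Boundaryless]
  [I₂.Boundaryless] [I₃.Boundaryless] [IsManifold I₁ ∞ M] [IsManifold I₂ ∞ P] [IsManifold I₃ ∞ N] in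
theorem mfderiv_fibred {Ψ : M × P → N} {c₀ : M} {y₀ : P}
    (hd : MDifferentiableAt (I₁.prod I₂) I₃ Ψ (c₀, y₀)) (v : E₁ × E₂) :
    mfderiv (I₁.prod I₂) (I₃.prod I₂) (fun q : M × P => (Ψ q, q.2)) (c₀, y₀) v
      = ((mfderiv I₁ I₃ (fun c => Ψ (c, y₀)) c₀ v.1 + mfderiv I₂ I₃ (fun y => Ψ (c₀, y)) y₀ v.2 : E₃),
        v.2) := by
  rw [mfderiv_prodMk hd mdifferentiableAt_snd, mfderiv_snd]
  exact Prod.ext (mfderiv_prod_eq_add_apply hd) rfl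

/-- A family of maps `Ψ(·, y)` depending on a parameter `y` is a local diffeomorphism of total
spaces wherever the derivative in the first variable alone is bijective. -/
theorem isLocalDiffeomorphAt_fibred {Ψ : M × P → N} {c₀ : M} {y₀ : P}
    (hΨ : ∀ᶠ q in 𝓝 (c₀, y₀), ContMDiffAt (I₁.prod I₂) I₃ ∞ Ψ q)
    (hb : Function.Bijective (mfderiv I₁ I₃ (fun c => Ψ (c, y₀)) c₀)) :
    IsLocalDiffeomorphAt (I₁.prod I₂) (I₃.prod I₂) ∞ (fun q : M × P => (Ψ q, q.2)) (c₀, y₀) := by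
  refine isLocalDiffeomorphAt_of_bijective_mfderiv (hΨ.mono fun q hq => hq.prodMk contMDiffAt_snd) ?_
  have hm := mfderiv_fibred (hΨ.self_of_nhds.mdifferentiableAt (by simp))
  constructor
  · intro v w hvw
    rw [hm v, hm w] at hvw
    obtain ⟨h1, h2⟩ := Prod.ext_iff.1 hvw
    dsimp only at h1 h2
    rw [h2] at h1
    exact Prod.ext (hb.1 (add_right_cancel h1)) h2
  · rintro ⟨a, b⟩
    obtain ⟨v, hv⟩ := hb.2 ((show E₃ from a) - (show E₃ from mfderiv I₂ I₃ (fun y => Ψ (c₀, y)) y₀ b))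
    refine ⟨((v, b) : E₁ × E₂), ?_⟩
    rw [hm (v, b)]
    refine Prod.ext ?_ rfl
    dsimp only
    rw [hv]
    exact sub_add_cancel (a : E₃) _

/-- A family `Ψ(·, y)` whose partial derivative is bijective at `(c₀, y₀)` is injective near `c₀`,
uniformly in the parameter `y` near `y₀`. -/
theorem eventually_injective_of_bijective_mfderiv {Ψ : M × P → N} {c₀ : M} {y₀ : P}
    (hΨ : ∀ᶠ q in 𝓝 (c₀, y₀), ContMDiffAt (I₁.prod I₂) I₃ ∞ Ψ q)
    (hb : Function.Bijective (mfderiv I₁ I₃ (fun c => Ψ (c, y₀)) c₀)) :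
    ∀ᶠ q : (M × M) × P in 𝓝 ((c₀, c₀), y₀),
      Ψ (q.1.1, q.2) = Ψ (q.1.2, q.2) → q.1.1 = q.1.2 := by
  obtain ⟨Φ, hs, hΦ⟩ := isLocalDiffeomorphAt_fibred hΨ hb
  have hU := Φ.open_source.mem_nhds hs
  have h1 : Tendsto (fun q : (M × M) × P => (q.1.1, q.2)) (𝓝 ((c₀, c₀), y₀)) (𝓝 (c₀, y₀)) :=
    Continuous.tendsto (by fun_prop) _
  have h2 : Tendsto (fun q : (M × M) × P => (q.1.2, q.2)) (𝓝 ((c₀, c₀), y₀)) (𝓝 (c₀, y₀)) :=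
    Continuous.tendsto (by fun_prop) _
  filter_upwards [h1 hU, h2 hU] with q hq1 hq2 heq
  have := Φ.injOn hq1 hq2 (by rw [← hΦ hq1, ← hΦ hq2]; exact Prod.ext heq rfl)
  exact congrArg Prod.fst this

/-- **Implicit function theorem**: near `y₀` the equation `Ψ(c, y) = 0` has a smooth solution
`c(y)`, and by local uniqueness the solution is `0` whenever `0` solves the equation. -/
theorem exists_implicit_solution {V W : Type*} [NormedAddCommGroup V] [NormedSpace ℝ V]
    [CompleteSpace V] [NormedAddCommGroup W] [NormedSpace ℝ W] [CompleteSpace W]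
    {Ψ : V × P → W} {y₀ : P}
    (hΨ : ∀ᶠ q in 𝓝 ((0 : V), y₀), ContMDiffAt (𝓘(ℝ, V).prod I₂) 𝓘(ℝ, W) ∞ Ψ q)
    (h0 : Ψ (0, y₀) = 0) (hb : Function.Bijective (fderiv ℝ (fun c => Ψ (c, y₀)) 0)) :
    ∃ c : P → V, ∃ O : Set P, IsOpen O ∧ y₀ ∈ O ∧ ContMDiffOn I₂ 𝓘(ℝ, V) ∞ c O ∧
      (∀ y ∈ O, Ψ (c y, y) = 0) ∧ (∀ y ∈ O, Ψ (0, y) = 0 → c y = 0) := by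
  obtain ⟨Φ, hs, hΦ⟩ := isLocalDiffeomorphAt_fibred (I₁ := 𝓘(ℝ, V)) (I₃ := 𝓘(ℝ, W)) hΨ
    (by rw [mfderiv_eq_fderiv]; exact hb)
  have hι' : ContMDiff I₂ (𝓘(ℝ, W).prod I₂) ∞ (fun y : P => ((0 : W), y)) :=
    contMDiff_const.prodMk contMDiff_id
  refine ⟨fun y => (Φ.symm (0, y)).1, (fun y : P => ((0 : V), y)) ⁻¹' Φ.source ∩
    (fun y : P => ((0 : W), y)) ⁻¹' Φ.target, ?_, ⟨hs, ?_⟩, ?_, ?_, ?_⟩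
  · exact (Φ.open_source.preimage (by fun_prop)).inter (Φ.open_target.preimage hι'.continuous)
  · have := Φ.map_source hs
    rw [← hΦ hs] at this
    change (Ψ (0, y₀), y₀) ∈ Φ.target at this
    rwa [h0] at this
  · intro y hy
    have h1 : ContMDiffAt (𝓘(ℝ, W).prod I₂) (𝓘(ℝ, V).prod I₂) ∞ Φ.symm (0, y) :=
      Φ.symm.contMDiffOn.contMDiffAt (Φ.open_target.mem_nhds hy.2)
    exact (contMDiffAt_fst.comp y (h1.comp y hι'.contMDiffAt)).contMDiffWithinAt
  · intro y hy
    have h1 : Φ.symm (0, y) ∈ Φ.source := Φ.map_target hy.2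
    have h2 : Φ (Φ.symm (0, y)) = (0, y) := Φ.right_inv hy.2
    rw [← hΦ h1] at h2
    obtain ⟨h3, h4⟩ := Prod.ext_iff.1 h2
    dsimp only at h3 h4
    have h5 : Φ.symm (0, y) = ((Φ.symm (0, y)).1, y) := Prod.ext rfl h4
    exact (congrArg Ψ h5).symm.trans h3
  · intro y hy hz
    have h1 : Φ (0, y) = (0, y) := by
      rw [← hΦ hy.1]; exact Prod.ext hz rfl
    have h2 : Φ.symm (Φ (0, y)) = (0, y) := Φ.left_inv hy.1
    rw [h1] at h2
    exact congrArg Prod.fst h2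

end FibredMaps

/-! ### Small deformations of the identity are diffeomorphisms -/

theorem IsCompact.eventually_forall_right {α β : Type*} [TopologicalSpace α] [TopologicalSpace β]
    {K : Set α} (hK : IsCompact K) {P : α → β → Prop} {b : β}
    (h : ∀ a ∈ K, ∀ᶠ q : α × β in 𝓝 (a, b), P q.1 q.2) : ∀ᶠ y in 𝓝 b, ∀ a ∈ K, P a y :=
  hK.eventually_forall_of_forall_eventually fun a ha =>
    (continuous_swap.tendsto (b, a)).eventually (h a ha)

section Deformation

variable {E : Type*} [NormedAddCommGroup E] [NormedSpace ℝ E] [CompleteSpace E]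
  {H : Type*} [TopologicalSpace H] {I : ModelWithCorners ℝ E H} [I.Boundaryless]
  {X : Type*} [TopologicalSpace X] [ChartedSpace H X] [IsManifold I ∞ X]
  {Z : Type*} [NormedAddCommGroup Z] [NormedSpace ℝ Z] [CompleteSpace Z]

omit [CompleteSpace E] [I.Boundaryless] [IsManifold I ∞ X] [CompleteSpace Z] in
/-- Where the total map `(x, z) ↦ (Ψ(x, z), z)` is a local diffeomorphism, the derivative of `Ψ` in
the first variable is bijective. -/
theorem mfderiv_slice_bijective {Ψ : X × Z → X} {x : X} {z : Z}
    (hΨ : ContMDiffAt (I.prod 𝓘(ℝ, Z)) I ∞ Ψ (x, z))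
    (h : IsLocalDiffeomorphAt (I.prod 𝓘(ℝ, Z)) (I.prod 𝓘(ℝ, Z)) ∞
      (fun q : X × Z => (Ψ q, q.2)) (x, z)) :
    Function.Bijective (mfderiv I I (fun x => Ψ (x, z)) x) := by
  have hm := mfderiv_fibred (hΨ.mdifferentiableAt (by simp))
  have hb : Function.Bijective (mfderiv (I.prod 𝓘(ℝ, Z)) (I.prod 𝓘(ℝ, Z))
      (fun q : X × Z => (Ψ q, q.2)) (x, z)) :=
    (h.mfderivToContinuousLinearEquiv (by simp)).bijective
  have hm' : ∀ u : E, mfderiv (I.prod 𝓘(ℝ, Z)) (I.prod 𝓘(ℝ, Z)) (fun q : X × Z => (Ψ q, q.2)) (x, z)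
      ((u, 0) : E × Z) = ((mfderiv I I (fun x => Ψ (x, z)) x u : E), (0 : Z)) := by
    intro u
    rw [hm]
    refine Prod.ext ?_ rfl
    exact (congrArg (fun w : E => (show E from mfderiv I I (fun x => Ψ (x, z)) x u) + w)
      (map_zero (mfderiv 𝓘(ℝ, Z) I (fun y => Ψ (x, y)) z))).trans (add_zero (_ : E))
  constructor
  · intro u v huv
    have h1 := hm' u
    rw [huv] at h1
    exact congrArg Prod.fst (hb.1 (h1.trans (hm' v).symm))
  · intro a
    obtain ⟨v, hv⟩ := hb.2 ((a, 0) : E × Z)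
    have h2 : (v : E × Z).2 = 0 := by
      have := hv
      rw [hm v] at this
      exact congrArg Prod.snd this
    have h3 : v = (((v : E × Z).1, 0) : E × Z) := Prod.ext rfl h2
    rw [h3, hm'] at hv
    exact ⟨_, congrArg Prod.fst hv⟩

/-- A smooth family of self-maps that is the identity for the parameter `z₀`, and outside a fixed
compact set for every parameter, consists of diffeomorphisms for all parameters close to `z₀`. -/
theorem eventually_exists_diffeomorph [T2Space X] [LocallyCompactSpace X] {Ψ : X × Z → X} {z₀ : Z}
    (hΨ : ContMDiff (I.prod 𝓘(ℝ, Z)) I ∞ Ψ) (h0 : ∀ x, Ψ (x, z₀) = x) {K : Set X}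
    (hK : IsCompact K) (hout : ∀ x ∉ K, ∀ z, Ψ (x, z) = x) :
    ∀ᶠ z in 𝓝 z₀, ∃ Φ : X ≃ₘ^∞⟮I, I⟯ X, ∀ x, Φ x = Ψ (x, z) := by
  have hid : (fun x => Ψ (x, z₀)) = id := funext h0
  have hb : ∀ x, Function.Bijective (mfderiv I I (fun x => Ψ (x, z₀)) x) := by
    intro x
    rw [hid, mfderiv_id]
    exact Function.bijective_id
  have hloc := fun x => isLocalDiffeomorphAt_fibred (I₁ := I) (I₂ := 𝓘(ℝ, Z)) (I₃ := I)
    (Eventually.of_forall fun q => hΨ q) (hb x)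
  obtain ⟨K', hK', hKK'⟩ := exists_compact_superset hK
  -- local invertibility of each map
  have hder : ∀ᶠ z in 𝓝 z₀, ∀ x ∈ K, Function.Bijective (mfderiv I I (fun x => Ψ (x, z)) x) := by
    refine hK.eventually_forall_right fun x _ => ?_
    obtain ⟨Φ, hs, hΦ⟩ := hloc x
    filter_upwards [Φ.open_source.mem_nhds hs] with q hq
    exact mfderiv_slice_bijective (hΨ q) ⟨Φ, hq, hΦ⟩
  -- injectivity on a neighbourhood of `K`
  have hinj : ∀ᶠ z in 𝓝 z₀, ∀ q ∈ K' ×ˢ K', Ψ (q.1, z) = Ψ (q.2, z) → q.1 = q.2 := by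
    refine (hK'.prod hK').eventually_forall_right fun q _ => ?_
    obtain ⟨x, y⟩ := q
    by_cases hxy : x = y
    · subst hxy
      exact eventually_injective_of_bijective_mfderiv (I₁ := I) (I₂ := 𝓘(ℝ, Z)) (I₃ := I)
        (Eventually.of_forall fun q => hΨ q) (hb x)
    · have h1 : ContinuousAt (fun q : (X × X) × Z => Ψ (q.1.1, q.2)) ((x, y), z₀) :=
        (hΨ.continuous.comp (by fun_prop)).continuousAt
      have h2 : ContinuousAt (fun q : (X × X) × Z => Ψ (q.1.2, q.2)) ((x, y), z₀) :=
        (hΨ.continuous.comp (by fun_prop)).continuousAt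
      have h3 : ∀ᶠ q : (X × X) × Z in 𝓝 ((x, y), z₀), Ψ (q.1.1, q.2) ≠ Ψ (q.1.2, q.2) :=
        h1.ne_iff_eventually_ne h2 |>.1 (by simpa [h0] using hxy)
      exact h3.mono fun q hq heq => absurd heq hq
  have hmaps : ∀ᶠ z in 𝓝 z₀, ∀ x ∈ K, Ψ (x, z) ∈ K' := by
    refine hK.eventually_forall_right fun x hx => ?_
    refine hΨ.continuous.continuousAt.eventually_mem ?_
    rw [h0]
    exact mem_interior_iff_mem_nhds.1 (hKK' hx)
  -- surjectivity, from the openness of the total map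
  have hsurj : ∀ᶠ z in 𝓝 z₀, ∀ y ∈ K, ∃ x, Ψ (x, z) = y := by
    refine hK.eventually_forall_right fun y _ => ?_
    obtain ⟨Φ, hs, hΦ⟩ := hloc y
    have h1 : (y, z₀) ∈ Φ.target := by
      have := Φ.map_source hs
      rw [← hΦ hs] at this
      change (Ψ (y, z₀), z₀) ∈ Φ.target at this
      rwa [h0] at this
    filter_upwards [Φ.open_target.mem_nhds h1] with q hq
    have h2 : Φ (Φ.symm q) = q := Φ.right_inv hq
    have h5 : Φ.symm q ∈ Φ.source := Φ.map_target hq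
    rw [← hΦ h5] at h2
    obtain ⟨h3, h4⟩ := Prod.ext_iff.1 h2
    dsimp only at h3 h4
    refine ⟨(Φ.symm q).1, Eq.trans (congrArg Ψ ?_) h3⟩
    exact Prod.ext rfl h4.symm
  filter_upwards [hder, hinj, hmaps, hsurj] with z hder hinj hmaps hsurj
  have hld : IsLocalDiffeomorph I I ∞ (fun x => Ψ (x, z)) := by
    intro x
    have hs : ContMDiff I I ∞ (fun x => Ψ (x, z)) := hΨ.comp (contMDiff_id.prodMk contMDiff_const)
    refine isLocalDiffeomorphAt_of_bijective_mfderiv (Eventually.of_forall fun x => hs x) ?_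
    by_cases hx : x ∈ K
    · exact hder x hx
    · have : (fun x => Ψ (x, z)) =ᶠ[𝓝 x] id := by
        filter_upwards [hK.isClosed.isOpen_compl.mem_nhds hx] with y hy using hout y hy z
      rw [this.mfderiv_eq, mfderiv_id]
      exact Function.bijective_id
  have hinj' : Function.Injective (fun x => Ψ (x, z)) := by
    have hK'K : K ⊆ K' := hKK'.trans interior_subset
    intro x y hxy
    dsimp only at hxy
    by_cases hx : x ∈ K <;> by_cases hy : y ∈ K
    · exact hinj (x, y) ⟨hK'K hx, hK'K hy⟩ hxy
    · refine hinj (x, y) ⟨hK'K hx, ?_⟩ hxy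
      change y ∈ K'
      rw [← hout y hy z, ← hxy]
      exact hmaps x hx
    · refine hinj (x, y) ⟨?_, hK'K hy⟩ hxy
      change x ∈ K'
      rw [← hout x hx z, hxy]
      exact hmaps y hy
    · rwa [hout x hx, hout y hy] at hxy
  have hsurj' : Function.Surjective (fun x => Ψ (x, z)) := by
    intro y
    by_cases hy : y ∈ K
    · exact hsurj y hy
    · exact ⟨y, hout y hy z⟩
  exact ⟨hld.diffeomorphOfBijective ⟨hinj', hsurj'⟩, fun x => rfl⟩

end Deformation

/-! ### Patching local corrections -/

section Patching

variable {E : Type*} [NormedAddCommGroup E] [NormedSpace ℝ E]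
  {H : Type*} [TopologicalSpace H] (I : ModelWithCorners ℝ E H)
  {X : Type*} [TopologicalSpace X] [ChartedSpace H X]
  {Z : Type*} [NormedAddCommGroup Z] [NormedSpace ℝ Z]
  {V : Type*} [NormedAddCommGroup V] [NormedSpace ℝ V]

/-- A smooth family, with parameter `z`, of `V`-valued functions on `X` that vanishes identically
for `z = z₀`, and outside a fixed compact subset of `X` for every parameter. -/
structure IsCompactDeformation (z₀ : Z) (u : X × Z → V) : Prop where
  contMDiff : ContMDiff (I.prod 𝓘(ℝ, Z)) 𝓘(ℝ, V) ∞ u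
  eq_zero : ∀ x, u (x, z₀) = 0
  exists_compact : ∃ K, IsCompact K ∧ ∀ x ∉ K, ∀ z, u (x, z) = 0

variable {I}

theorem IsCompactDeformation.add_correction {z₀ : Z} {u : X × Z → V}
    (hu : IsCompactDeformation I z₀ u) {C : X × (Z × V) → V}
    (hC : ContMDiff (I.prod 𝓘(ℝ, Z × V)) 𝓘(ℝ, V) ∞ C)
    (hsupp : ∃ K, IsCompact K ∧ ∀ x ∉ K, ∀ y, C (x, y) = 0) (h0 : ∀ x, C (x, (z₀, 0)) = 0) :
    IsCompactDeformation I z₀ (fun q => u q + C (q.1, (q.2, u q))) := by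
  refine ⟨hu.contMDiff.add
    (hC.comp (contMDiff_fst.prodMk (contMDiff_snd.prodMk_space hu.contMDiff))), fun x => ?_, ?_⟩
  · simp only [hu.eq_zero, h0, add_zero]
  · obtain ⟨K, hK, hK0⟩ := hu.exists_compact
    obtain ⟨K', hK', hK0'⟩ := hsupp
    refine ⟨K ∪ K', hK.union hK', fun x hx z => ?_⟩
    rw [mem_union, not_or] at hx
    simp only [hK0 x hx.1, hK0' x hx.2, add_zero]

/-- Let `L x z w` be a condition on `w ∈ V` for each point `x` of `S` and each parameter `z`.
Suppose that near each point of the compact set `K` any `w` close to `0` can be corrected by a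
smooth function `C` of `(x, z, w)` so as to satisfy the condition, and that `C` leaves alone each
`w` that satisfies it already. Then there is a global smooth family that satisfies the condition
near `K` for parameters close to `z₀`. The second property of the corrections is what allows to
apply finitely many of them one after the other, where a partition of unity is of no use because
the condition is not convex. -/
theorem exists_compactDeformation_of_local_correction {K : Set X} (hK : IsCompact K) {S : Set X}
    {L : X → Z → V → Prop} {z₀ : Z}
    (hloc : ∀ p ∈ K, ∃ C : X × (Z × V) → V, ContMDiff (I.prod 𝓘(ℝ, Z × V)) 𝓘(ℝ, V) ∞ C ∧
      (∃ K, IsCompact K ∧ ∀ x ∉ K, ∀ y, C (x, y) = 0) ∧ (∀ x, C (x, (z₀, 0)) = 0) ∧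
      (∀ x ∈ S, ∀ z w, L x z w → C (x, (z, w)) = 0) ∧
      ∀ᶠ q : X × (Z × V) in 𝓝 (p, (z₀, 0)), q.1 ∈ S → L q.1 q.2.1 (q.2.2 + C q)) :
    ∃ u : X × Z → V, IsCompactDeformation I z₀ u ∧
      ∀ p ∈ K, ∀ᶠ q : X × Z in 𝓝 (p, z₀), q.1 ∈ S → L q.1 q.2 (u q) := by
  -- the statement is made for every initial `u`, so that it is stable under unions
  have key : ∀ u : X × Z → V, IsCompactDeformation I z₀ u →
      ∃ u' : X × Z → V, IsCompactDeformation I z₀ u' ∧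
        (∀ q : X × Z, q.1 ∈ S → L q.1 q.2 (u q) → L q.1 q.2 (u' q)) ∧
        ∀ p ∈ K, ∀ᶠ q : X × Z in 𝓝 (p, z₀), q.1 ∈ S → L q.1 q.2 (u' q) := by
    refine hK.induction_on (p := fun T => ∀ u : X × Z → V, IsCompactDeformation I z₀ u →
      ∃ u' : X × Z → V, IsCompactDeformation I z₀ u' ∧
        (∀ q : X × Z, q.1 ∈ S → L q.1 q.2 (u q) → L q.1 q.2 (u' q)) ∧
        ∀ p ∈ T, ∀ᶠ q : X × Z in 𝓝 (p, z₀), q.1 ∈ S → L q.1 q.2 (u' q)) ?_ ?_ ?_ ?_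
    · exact fun u hu => ⟨u, hu, fun _ _ h => h, fun p hp => absurd hp (notMem_empty p)⟩
    · intro s t hst ht u hu
      obtain ⟨u', h1, h2, h3⟩ := ht u hu
      exact ⟨u', h1, h2, fun p hp => h3 p (hst hp)⟩
    · intro s t hs ht u hu
      obtain ⟨u', h1, h2, h3⟩ := hs u hu
      obtain ⟨u'', h1', h2', h3'⟩ := ht u' h1
      refine ⟨u'', h1', fun q hq h => h2' q hq (h2 q hq h), fun p hp => ?_⟩
      rcases hp with hp | hp
      · exact (h3 p hp).mono fun q h hq => h2' q hq (h hq)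
      · exact h3' p hp
    · intro p hp
      obtain ⟨C, hC, hsupp, h0, hL, hcor⟩ := hloc p hp
      have hcont : Continuous fun x : X => (x, ((z₀, 0) : Z × V)) := by fun_prop
      refine ⟨_, mem_nhdsWithin_of_mem_nhds
        ((hcont.tendsto p).eventually (eventually_eventually_nhds.2 hcor)), fun u hu =>
        ⟨_, hu.add_correction hC hsupp h0, fun q hq h => ?_, fun x hx => ?_⟩⟩
      · rwa [hL q.1 hq q.2 (u q) h, add_zero]
      · have hcont' : Continuous fun q : X × Z => (q.1, (q.2, u q)) :=
          continuous_fst.prodMk (continuous_snd.prodMk hu.contMDiff.continuous)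
        have := hcont'.tendsto (x, z₀)
        rw [hu.eq_zero] at this
        exact this.eventually hx
  obtain ⟨u, hu, -, h⟩ := key (fun _ => 0)
    ⟨contMDiff_const, fun _ => rfl, ∅, isCompact_empty, fun _ _ _ => rfl⟩
  exact ⟨u, hu, h⟩

end Patching

/-! ### Isotopies along orbits -/

section LocalCorrection

variable {E : Type*} [NormedAddCommGroup E] [NormedSpace ℝ E] [FiniteDimensional ℝ E]
  {X : Type*} [TopologicalSpace X] [ChartedSpace E X] [IsManifold 𝓘(ℝ, E) ∞ X] [T2Space X]
  {Z : Type*} [NormedAddCommGroup Z] [NormedSpace ℝ Z] [FiniteDimensional ℝ Z]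
  {V : Type*} [NormedAddCommGroup V] [NormedSpace ℝ V] [FiniteDimensional ℝ V]
  {W : Type*} [NormedAddCommGroup W] [NormedSpace ℝ W] [FiniteDimensional ℝ W]

/-- The function `Q` is smooth near `(p, z₀)` and defines there the family `N z` of subsets of `X`
by the equation `Q(x, z) = 0`; moreover `Q(·, z₀)` is a submersion at `p` already in the directions
of the family of motions `α(·, w)`. -/
structure IsTransverseDefiningFunction (α : X × V → X) (N : Z → Set X) (p : X) (z₀ : Z)
    (Q : X × Z → W) : Prop where
  contMDiffAt : ∀ᶠ q in 𝓝 (p, z₀), ContMDiffAt (𝓘(ℝ, E).prod 𝓘(ℝ, Z)) 𝓘(ℝ, W) ∞ Q q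
  mem_iff : ∀ᶠ q : X × Z in 𝓝 (p, z₀), q.1 ∈ N q.2 ↔ Q q = 0
  surjective : Function.Surjective (fderiv ℝ (fun w => Q (α (p, w), z₀)) 0)

variable {α : X × V → X} {N : Z → Set X} {p : X} {z₀ : Z} {Q : X × Z → W}

omit [FiniteDimensional ℝ E] [IsManifold 𝓘(ℝ, E) ∞ X] [T2Space X] [FiniteDimensional ℝ Z]
  [FiniteDimensional ℝ V] in
theorem IsTransverseDefiningFunction.exists_rightInverse
    (hQ : IsTransverseDefiningFunction (E := E) α N p z₀ Q)
    (hα : ContMDiff (𝓘(ℝ, E).prod 𝓘(ℝ, V)) 𝓘(ℝ, E) ∞ α) (hα0 : ∀ x, α (x, 0) = x) :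
    ∃ P : W →L[ℝ] V, fderiv ℝ (fun c => Q (α (p, P c), z₀)) 0 = ContinuousLinearMap.id ℝ W := by
  obtain ⟨P, hP⟩ := LinearMap.exists_rightInverse_of_surjective
    (fderiv ℝ (fun w => Q (α (p, w), z₀)) 0 : V →ₗ[ℝ] W) (LinearMap.range_eq_top.2 hQ.surjective)
  refine ⟨P.toContinuousLinearMap, ?_⟩
  have h1 : ContMDiffAt 𝓘(ℝ, V) 𝓘(ℝ, W) ∞ (fun w => Q (α (p, w), z₀)) 0 := by
    refine ContMDiffAt.comp (I' := 𝓘(ℝ, E).prod 𝓘(ℝ, Z)) (0 : V) (g := Q)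
      (f := fun w => (α (p, w), z₀)) ?_ ?_
    · rw [hα0]
      exact hQ.contMDiffAt.self_of_nhds
    · exact ((hα.comp (contMDiff_const.prodMk contMDiff_id)).prodMk contMDiff_const) 0
  have h2 : DifferentiableAt ℝ (fun w => Q (α (p, w), z₀)) (P.toContinuousLinearMap 0) := by
    rw [map_zero]
    exact h1.contDiffAt.differentiableAt (by simp)
  have h3 := fderiv_comp (0 : W) h2 P.toContinuousLinearMap.differentiableAt
  rw [Function.comp_def] at h3
  rw [h3, P.toContinuousLinearMap.fderiv, map_zero]
  ext1 c
  exact LinearMap.congr_fun hP c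

omit [FiniteDimensional ℝ E] [IsManifold 𝓘(ℝ, E) ∞ X] [T2Space X] [FiniteDimensional ℝ Z]
  [FiniteDimensional ℝ V] [FiniteDimensional ℝ W] in
theorem eventually_contMDiffAt_comp {F : Type*} [NormedAddCommGroup F] [NormedSpace ℝ F]
    {H : Type*} [TopologicalSpace H] {J : ModelWithCorners ℝ F H}
    {A : Type*} [TopologicalSpace A] [ChartedSpace H A] {m : A → X × Z} {a : A}
    (hQ : ∀ᶠ q in 𝓝 (p, z₀), ContMDiffAt (𝓘(ℝ, E).prod 𝓘(ℝ, Z)) 𝓘(ℝ, W) ∞ Q q)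
    (hm : ContMDiff J (𝓘(ℝ, E).prod 𝓘(ℝ, Z)) ∞ m) (ha : m a = (p, z₀)) :
    ∀ᶠ b in 𝓝 a, ContMDiffAt J 𝓘(ℝ, W) ∞ (fun b => Q (m b)) b := by
  have := hm.continuous.tendsto a
  rw [ha] at this
  exact (this.eventually hQ).mono fun b hb => hb.comp b (hm b)

/-- Near a point with a transverse defining function, any small motion can be corrected so as to
carry `N z₀` into `N z`. The correction solves `Q(α(x, w + Pc), z) = Q(x, z₀)` for `c`
in a space `W` of directions, embedded by `P`, in which the derivative is invertible. -/
theorem IsTransverseDefiningFunction.exists_correction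
    (hQ : IsTransverseDefiningFunction (E := E) α N p z₀ Q)
    (hα : ContMDiff (𝓘(ℝ, E).prod 𝓘(ℝ, V)) 𝓘(ℝ, E) ∞ α) (hα0 : ∀ x, α (x, 0) = x) :
    ∃ C : X × (Z × V) → V, ContMDiff (𝓘(ℝ, E).prod 𝓘(ℝ, Z × V)) 𝓘(ℝ, V) ∞ C ∧
      (∃ K, IsCompact K ∧ ∀ x ∉ K, ∀ y, C (x, y) = 0) ∧ (∀ x, C (x, (z₀, 0)) = 0) ∧
      (∀ x ∈ N z₀, ∀ z w, α (x, w) ∈ N z → C (x, (z, w)) = 0) ∧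
      ∀ᶠ q : X × (Z × V) in 𝓝 (p, (z₀, 0)),
        q.1 ∈ N z₀ → α (q.1, q.2.2 + C q) ∈ N q.2.1 := by
  obtain ⟨P, hP⟩ := hQ.exists_rightInverse hα hα0
  -- the motion, the undisplaced point, and the motion before correction, with their parameters
  let m : W × (X × (Z × V)) → X × Z := fun q => (α (q.2.1, q.2.2.2 + P q.1), q.2.2.1)
  let m₀ : X × (Z × V) → X × Z := fun y => (y.1, z₀)
  let m₁ : X × (Z × V) → X × Z := fun y => (α (y.1, y.2.2), y.2.1)
  have hz : ContMDiff 𝓘(ℝ, Z × V) 𝓘(ℝ, Z) ∞ (Prod.fst : Z × V → Z) := contDiff_fst.contMDiff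
  have hw : ContMDiff 𝓘(ℝ, Z × V) 𝓘(ℝ, V) ∞ (Prod.snd : Z × V → V) := contDiff_snd.contMDiff
  have hm : ContMDiff (𝓘(ℝ, W).prod (𝓘(ℝ, E).prod 𝓘(ℝ, Z × V))) (𝓘(ℝ, E).prod 𝓘(ℝ, Z)) ∞ m := by
    refine ContMDiff.prodMk (hα.comp (ContMDiff.prodMk contMDiff_snd.fst (ContMDiff.add ?_ ?_))) ?_
    · exact hw.comp contMDiff_snd.snd
    · exact P.contMDiff.comp contMDiff_fst
    · exact hz.comp contMDiff_snd.snd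
  have hm₀ : ContMDiff (𝓘(ℝ, E).prod 𝓘(ℝ, Z × V)) (𝓘(ℝ, E).prod 𝓘(ℝ, Z)) ∞ m₀ :=
    contMDiff_fst.prodMk contMDiff_const
  have hm₁ : Continuous m₁ := by
    have := hα.continuous
    fun_prop
  set y₀ : X × (Z × V) := (p, (z₀, 0)) with hy₀
  have hmy : m (0, y₀) = (p, z₀) := by simp [m, y₀, hα0]
  have hm₁y : m₁ y₀ = (p, z₀) := by simp [m₁, y₀, hα0]
  obtain ⟨c, O, hO, hyO, hc, hcz, hcu⟩ := exists_implicit_solution (P := X × (Z × V))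
    (Ψ := fun q => Q (m q) - Q (m₀ q.2)) (y₀ := y₀)
    (I₂ := 𝓘(ℝ, E).prod 𝓘(ℝ, Z × V)) (by
      filter_upwards [eventually_contMDiffAt_comp hQ.contMDiffAt hm hmy,
        eventually_contMDiffAt_comp (a := ((0 : W), y₀)) hQ.contMDiffAt
          (hm₀.comp (contMDiff_snd (I := 𝓘(ℝ, W)))) rfl] with q h1 h2 using h1.sub h2)
    (by simp [hmy, m₀, y₀])
    (by
      have : (fun c : W => Q (m (c, y₀)) - Q (m₀ y₀)) =
          fun c => Q (α (p, P c), z₀) - Q (m₀ y₀) := by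
        funext c; simp [m, y₀]
      rw [this, fderiv_sub_const, hP]
      exact Function.bijective_id)
  -- shrink the domain so that `Q` decides membership in `N z₀` and `N z`
  obtain ⟨O', hO'sub, hO', hyO'⟩ := eventually_nhds_iff.1
    (((hm₀.continuous.tendsto y₀).eventually hQ.mem_iff).and
      ((show Tendsto m₁ (𝓝 y₀) (𝓝 (p, z₀)) from hm₁y ▸ hm₁.tendsto y₀).eventually hQ.mem_iff))
  obtain ⟨χ, -, hχ⟩ := (SmoothBumpFunction.nhds_basis_tsupport
    (I := 𝓘(ℝ, E).prod 𝓘(ℝ, Z × V)) y₀).mem_iff.1 ((hO.inter hO').mem_nhds ⟨hyO, hyO'⟩)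
  have hzero : ∀ y : X × (Z × V), (y ∈ O → y ∈ O' → c y = 0) → χ y • P (c y) = 0 := by
    intro y hy
    by_cases h : y ∈ tsupport χ
    · rw [hy (hχ h).1 (hχ h).2, map_zero, smul_zero]
    · rw [image_eq_zero_of_notMem_tsupport h, zero_smul]
  have hcy : ∀ x, (x, ((z₀, 0) : Z × V)) ∈ O → c (x, (z₀, 0)) = 0 :=
    fun x hx => hcu _ hx (by simp [m, m₀, hα0])
  refine ⟨fun y => χ y • P (c y), ?_, ⟨Prod.fst '' tsupport χ, ?_, ?_⟩, ?_, ?_, ?_⟩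
  · refine contMDiff_of_tsupport fun y hy => ?_
    have hyO := (hχ (tsupport_smul_subset_left (f := χ) _ hy)).1
    exact χ.contMDiffAt.smul (P.contMDiff.contMDiffAt.comp y (hc.contMDiffAt (hO.mem_nhds hyO)))
  · exact χ.hasCompactSupport.isCompact.image continuous_fst
  · intro x hx y
    have : (x, y) ∉ tsupport χ := fun h => hx ⟨_, h, rfl⟩
    simp only [image_eq_zero_of_notMem_tsupport this, zero_smul]
  · exact fun x => hzero _ fun h _ => hcy x h
  · intro x hx z w hxw
    refine hzero _ fun h h' => hcu _ h ?_
    have h1 : Q (x, z₀) = 0 := (hO'sub _ h').1.1 hx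
    have h2 : Q (α (x, w), z) = 0 := (hO'sub _ h').2.1 hxw
    simp [m, m₀, h1, h2]
  · have hcont : Tendsto (fun y => m (c y, y)) (𝓝 y₀) (𝓝 (p, z₀)) := by
      have h1 : Tendsto c (𝓝 y₀) (𝓝 0) := by
        have := (hc.contMDiffAt (hO.mem_nhds hyO)).continuousAt
        rwa [ContinuousAt, hcy p hyO] at this
      have h2 := hm.continuous.tendsto ((0 : W), y₀)
      rw [hmy] at h2
      exact h2.comp (h1.prodMk_nhds tendsto_id)
    filter_upwards [χ.eventuallyEq_one, hO.mem_nhds hyO, hO'.mem_nhds hyO',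
      hcont.eventually hQ.mem_iff] with y hχy hyO hyO' hy hyN
    rw [hχy]
    simp only [Pi.one_apply, one_smul]
    refine hy.2 ?_
    have h1 : Q (m₀ y) = 0 := (hO'sub _ hyO').1.1 hyN
    have h2 := hcz y hyO
    simpa [h1] using h2

omit [T2Space X] [FiniteDimensional ℝ V] in
/-- If a family of motions, equal to the identity for `z = z₀`, carries `N z₀` into `N z` near `p`,
then conversely only points of `N z₀` are carried into `N z`. Indeed, a point `x` near `p` can be
moved into `N z₀` in a direction transverse to it; the images of `x` and of the moved point both lie
in `N z`, and this is possible only if the two points are equal. -/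
theorem IsTransverseDefiningFunction.eventually_mem_of_deformation
    (hQ : IsTransverseDefiningFunction (E := E) α N p z₀ Q)
    (hα : ContMDiff (𝓘(ℝ, E).prod 𝓘(ℝ, V)) 𝓘(ℝ, E) ∞ α) (hα0 : ∀ x, α (x, 0) = x)
    {u : X × Z → V} (hu : ContMDiff (𝓘(ℝ, E).prod 𝓘(ℝ, Z)) 𝓘(ℝ, V) ∞ u)
    (hu0 : ∀ x, u (x, z₀) = 0)
    (hmem : ∀ᶠ q : X × Z in 𝓝 (p, z₀), q.1 ∈ N z₀ → α (q.1, u q) ∈ N q.2) :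
    ∀ᶠ q : X × Z in 𝓝 (p, z₀), α (q.1, u q) ∈ N q.2 → q.1 ∈ N z₀ := by
  obtain ⟨P, hP⟩ := hQ.exists_rightInverse hα hα0
  let Φ : X × Z → X × Z := fun q => (α (q.1, u q), q.2)
  have hΦ : ContMDiff (𝓘(ℝ, E).prod 𝓘(ℝ, Z)) (𝓘(ℝ, E).prod 𝓘(ℝ, Z)) ∞ Φ :=
    (hα.comp (contMDiff_fst.prodMk hu)).prodMk contMDiff_snd
  have hΦ0 : ∀ x, Φ (x, z₀) = (x, z₀) := fun x => by simp [Φ, hu0, hα0]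
  have hΦt : Tendsto Φ (𝓝 (p, z₀)) (𝓝 (p, z₀)) := by
    have := hΦ.continuous.tendsto (p, z₀)
    rwa [hΦ0] at this
  by_cases hQp : Q (p, z₀) = 0
  swap
  · have h1 : Tendsto Q (𝓝 (p, z₀)) (𝓝 (Q (p, z₀))) := hQ.contMDiffAt.self_of_nhds.continuousAt
    filter_upwards [(h1.comp hΦt).eventually_ne hQp, hΦt.eventually hQ.mem_iff] with q h2 h3 h4
    exact absurd (h3.1 h4) h2
  -- `m` moves points in the directions transverse to `N z₀`
  let m : W × X → X := fun q => α (q.2, P q.1)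
  have hm : ContMDiff (𝓘(ℝ, W).prod 𝓘(ℝ, E)) 𝓘(ℝ, E) ∞ m :=
    hα.comp (contMDiff_snd.prodMk (P.contMDiff.comp contMDiff_fst))
  have hm0 : ∀ x, m (0, x) = x := fun x => by simp [m, hα0]
  have hmz : ContMDiff (𝓘(ℝ, W).prod 𝓘(ℝ, E)) (𝓘(ℝ, E).prod 𝓘(ℝ, Z)) ∞
      (fun q : W × X => (m q, z₀)) := hm.prodMk contMDiff_const
  obtain ⟨t, O, hO, hpO, ht, htz, htu⟩ := exists_implicit_solution (P := X)
    (Ψ := fun q : W × X => Q (m q, z₀)) (y₀ := p) (I₂ := 𝓘(ℝ, E))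
    (eventually_contMDiffAt_comp hQ.contMDiffAt hmz (by rw [hm0])) (by simp only [hm0, hQp])
    (by
      simp only [m]
      rw [hP]
      exact Function.bijective_id)
  have htp : t p = 0 := htu p hpO (by simp only [hm0, hQp])
  have htt : Tendsto (fun q : X × Z => t q.1) (𝓝 (p, z₀)) (𝓝 0) := by
    have := (ht.contMDiffAt (hO.mem_nhds hpO)).continuousAt
    rw [ContinuousAt, htp] at this
    exact this.comp (continuous_fst.tendsto (p, z₀))
  have hmΦ : ContMDiff (𝓘(ℝ, W).prod (𝓘(ℝ, E).prod 𝓘(ℝ, Z))) (𝓘(ℝ, E).prod 𝓘(ℝ, Z)) ∞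
      (fun q : W × (X × Z) => Φ (m (q.1, q.2.1), q.2.2)) :=
    hΦ.comp ((hm.comp (contMDiff_fst.prodMk contMDiff_snd.fst)).prodMk contMDiff_snd.snd)
  have hinj := eventually_injective_of_bijective_mfderiv (I₁ := 𝓘(ℝ, W)) (I₃ := 𝓘(ℝ, W))
    (c₀ := (0 : W)) (y₀ := (p, z₀)) (Ψ := fun q : W × (X × Z) => Q (Φ (m (q.1, q.2.1), q.2.2)))
    (eventually_contMDiffAt_comp hQ.contMDiffAt hmΦ (by simp only [hm0, hΦ0]))
    (by
      have heq : (fun c : W => Q (Φ (m (c, p), z₀))) = fun c => Q (α (p, P c), z₀) :=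
        funext fun c => by rw [hΦ0]
      change Function.Bijective (mfderiv 𝓘(ℝ, W) 𝓘(ℝ, W) (fun c => Q (Φ (m (c, p), z₀))) 0)
      rw [heq, mfderiv_eq_fderiv, hP]
      exact Function.bijective_id)
  have hinj' : ∀ᶠ q : X × Z in 𝓝 (p, z₀),
      Q (Φ (m (t q.1, q.1), q.2)) = Q (Φ (m (0, q.1), q.2)) → t q.1 = 0 :=
    ((htt.prodMk_nhds tendsto_const_nhds).prodMk_nhds tendsto_id).eventually hinj
  have hmt : Tendsto (fun q : X × Z => m (t q.1, q.1)) (𝓝 (p, z₀)) (𝓝 p) := by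
    have := hm.continuous.tendsto ((0 : W), p)
    rw [hm0] at this
    exact this.comp (htt.prodMk_nhds (continuous_fst.tendsto (p, z₀)))
  have hsnd : Tendsto (Prod.snd : X × Z → Z) (𝓝 (p, z₀)) (𝓝 z₀) := continuous_snd.tendsto (p, z₀)
  have hfst : Tendsto (Prod.fst : X × Z → X) (𝓝 (p, z₀)) (𝓝 p) := continuous_fst.tendsto (p, z₀)
  filter_upwards [hinj', hfst (hO.mem_nhds hpO),
    (hmt.prodMk_nhds hsnd).eventually hmem,
    (hmt.prodMk_nhds (tendsto_const_nhds (x := z₀))).eventually hQ.mem_iff,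
    (hΦt.comp (hmt.prodMk_nhds hsnd)).eventually hQ.mem_iff,
    hΦt.eventually hQ.mem_iff,
    (hfst.prodMk_nhds (tendsto_const_nhds (x := z₀))).eventually hQ.mem_iff]
    with q hq hqO hq1 hq2 hq3 hq4 hq5 hqN
  have h1 : m (t q.1, q.1) ∈ N z₀ := hq2.2 (htz _ hqO)
  have h2 : Q (Φ (m (t q.1, q.1), q.2)) = 0 := hq3.1 (hq1 h1)
  have h3 : Q (Φ (m (0, q.1), q.2)) = 0 := by
    rw [hm0]
    exact hq4.1 hqN
  have h4 := htz _ hqO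
  rw [hq (h2.trans h3.symm)] at h4
  simp only [hm0] at h4
  exact hq5.2 h4

/-- **Isotopy theorem.** If each point of the closure of an invariant set `Y` has a neighbourhood that
`N z` does not meet for `z` close to `z₀`, or one in which `N z` has a defining function transverse
to the orbits, then `N z₀ ∩ Y` is carried onto `N z ∩ Y` by an orbit-preserving diffeomorphism for
all `z` close to `z₀`. -/
theorem eventually_exists_orbitPreserving {G : Type*} [Group G] [MulAction G X]
    (hα : ContMDiff (𝓘(ℝ, E).prod 𝓘(ℝ, V)) 𝓘(ℝ, E) ∞ α) (hα0 : ∀ x, α (x, 0) = x)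
    (hαG : ∀ x w, α (x, w) ∈ MulAction.orbit G x) {Y : Set X} (hY : ∀ g : G, ∀ y ∈ Y, g • y ∈ Y)
    (hYc : IsCompact (closure Y))
    (hN : ∀ p ∈ closure Y, (∀ᶠ q : X × Z in 𝓝 (p, z₀), q.1 ∉ N q.2) ∨
      ∃ Q : X × Z → W, IsTransverseDefiningFunction (E := E) α N p z₀ Q) :
    ∀ᶠ z in 𝓝 z₀, ∃ Φ : X ≃ₘ^∞⟮𝓘(ℝ, E), 𝓘(ℝ, E)⟯ X,
      OrbitPreserving G Φ ∧ Φ '' (N z₀ ∩ Y) = N z ∩ Y := by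
  have : LocallyCompactSpace X := ChartedSpace.locallyCompactSpace E X
  obtain ⟨u, hu, huN⟩ := exists_compactDeformation_of_local_correction (I := 𝓘(ℝ, E)) (V := V) hYc
    (S := N z₀) (L := fun x z w => α (x, w) ∈ N z) (z₀ := z₀) (by
      intro p hp
      rcases hN p hp with h | ⟨Q, hQ⟩
      · refine ⟨fun _ => 0, contMDiff_const, ⟨∅, isCompact_empty, fun _ _ _ => rfl⟩,
          fun _ => rfl, fun _ _ _ _ _ => rfl, ?_⟩
        have h1 : Tendsto (fun q : X × (Z × V) => (q.1, z₀)) (𝓝 (p, (z₀, 0))) (𝓝 (p, z₀)) :=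
          Continuous.tendsto (by fun_prop) _
        filter_upwards [h1.eventually h] with q hq hq'
        exact absurd hq' hq
      · exact hQ.exists_correction hα hα0)
  have hΨ : ContMDiff (𝓘(ℝ, E).prod 𝓘(ℝ, Z)) 𝓘(ℝ, E) ∞ (fun q : X × Z => α (q.1, u q)) :=
    hα.comp (contMDiff_fst.prodMk hu.contMDiff)
  obtain ⟨K, hK, hK0⟩ := hu.exists_compact
  have hconv : ∀ p ∈ closure Y, ∀ᶠ q : X × Z in 𝓝 (p, z₀), α (q.1, u q) ∈ N q.2 → q.1 ∈ N z₀ := by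
    intro p hp
    rcases hN p hp with h | ⟨Q, hQ⟩
    · have h1 : Tendsto (fun q : X × Z => (α (q.1, u q), q.2)) (𝓝 (p, z₀)) (𝓝 (p, z₀)) := by
        have := (hΨ.prodMk contMDiff_snd).continuous.tendsto (p, z₀)
        rwa [hu.eq_zero, hα0] at this
      filter_upwards [h1.eventually h] with q hq hq'
      exact absurd hq' hq
    · exact hQ.eventually_mem_of_deformation hα hα0 hu.contMDiff hu.eq_zero (huN p hp)
  filter_upwards [eventually_exists_diffeomorph hΨ (z₀ := z₀) (fun x => by simp [hu.eq_zero, hα0])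
      hK (fun x hx z => by simp [hK0 x hx, hα0]),
    hYc.eventually_forall_right (P := fun x z => x ∈ N z₀ → α (x, u (x, z)) ∈ N z) huN,
    hYc.eventually_forall_right (P := fun x z => α (x, u (x, z)) ∈ N z → x ∈ N z₀) hconv]
    with z hz h1 h2
  obtain ⟨Φ, hΦ⟩ := hz
  have hΦG : ∀ x, Φ x ∈ MulAction.orbit G x := fun x => hΦ x ▸ hαG _ _
  have hΦY : ∀ x, Φ x ∈ Y ↔ x ∈ Y := by
    intro x
    obtain ⟨g, hg⟩ := hΦG x
    constructor
    · intro h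
      have := hY g⁻¹ _ h
      rwa [← hg, inv_smul_smul] at this
    · intro h
      rw [← hg]
      exact hY g x h
  refine ⟨Φ, fun y => ?_, ?_⟩
  · ext x
    constructor
    · rintro ⟨x', hx', rfl⟩
      rw [← MulAction.orbit_eq_iff.2 hx']
      exact hΦG x'
    · intro hx
      obtain ⟨x', rfl⟩ : ∃ x', Φ x' = x := Φ.surjective x
      refine ⟨x', ?_, rfl⟩
      rw [← MulAction.orbit_eq_iff] at hx ⊢
      rw [← hx, MulAction.orbit_eq_iff.2 (hΦG x')]
  · ext x
    obtain ⟨x', rfl⟩ : ∃ x', Φ x' = x := Φ.surjective x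
    refine (Φ.injective.mem_set_image (a := x')).trans ?_
    constructor
    · rintro ⟨hx, hx'⟩
      exact ⟨hΦ x' ▸ h1 x' (subset_closure hx') hx, (hΦY x').2 hx'⟩
    · rintro ⟨hx, hx'⟩
      have hY' := (hΦY x').1 hx'
      exact ⟨h2 x' (subset_closure hY') (hΦ x' ▸ hx), hY'⟩

end LocalCorrection

/-! ### Vector fields generated by a family of motions -/

section MotionField

variable {E : Type*} [NormedAddCommGroup E] [NormedSpace ℝ E]
  {H : Type*} [TopologicalSpace H] (I : ModelWithCorners ℝ E H)
  {M : Type*} [TopologicalSpace M] [ChartedSpace H M]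
  {V : Type*} [NormedAddCommGroup V] [NormedSpace ℝ V]
  {W : Type*} [NormedAddCommGroup W] [NormedSpace ℝ W]

/-- The vector field `p ↦ d/dt|₀ α(p, t φ(p))` of initial velocities of a family of motions
`α(·, w)` with `α(·, 0) = id`, in the direction `φ(p)`. The tangent space at `α(p, 0)` is
identified with the one at `p` through the model space of both. -/
noncomputable def motionField (α : M × V → M) (φ : M → V) (p : M) : TangentSpace I p :=
  (mfderiv 𝓘(ℝ, V) I (fun w => α (p, w)) 0 : V →L[ℝ] E) (φ p)

variable {I} {α : M × V → M}

theorem tangentBundle_mk_eq_of_eq {p q : M} (h : q = p) (e : E) :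
    (⟨q, e⟩ : TangentBundle I M) = ⟨p, e⟩ := by
  subst h; rfl

theorem motionField_eq_zero {φ : M → V} {p : M} (h : φ p = 0) : motionField I α φ p = 0 := by
  rw [motionField, h]
  exact map_zero (mfderiv 𝓘(ℝ, V) I (fun w => α (p, w)) 0 : V →L[ℝ] E)

theorem contMDiff_slice (hα : ContMDiff (I.prod 𝓘(ℝ, V)) I ∞ α) (p : M) :
    ContMDiff 𝓘(ℝ, V) I ∞ (fun w => α (p, w)) :=
  hα.comp (contMDiff_const.prodMk contMDiff_id)

theorem isSmoothVectorField_motionField [IsManifold I ∞ M]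
    (hα : ContMDiff (I.prod 𝓘(ℝ, V)) I ∞ α) (hα0 : ∀ p, α (p, 0) = p) {φ : M → V}
    (hφ : ContMDiff I 𝓘(ℝ, V) ∞ φ) : IsSmoothVectorField I (motionField I α φ) := by
  have : IsManifold I 1 M := IsManifold.of_le (n := ∞) (by simp)
  intro p
  have h1 := ContMDiffAt.mfderiv (x₀ := p) (m := ∞) (fun p w => α (p, w)) (fun _ => (0 : V)) (hα _)
    contMDiffAt_const (by simp)
  have h2 : ContMDiffAt I 𝓘(ℝ, V).tangent ∞
      (fun p => (⟨0, φ p⟩ : TangentBundle 𝓘(ℝ, V) V)) p := by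
    rw [Bundle.contMDiffAt_totalSpace]
    refine ⟨contMDiffAt_const, ?_⟩
    simpa using hφ p
  have h3 := ContMDiffAt.clm_apply_of_inCoordinates (IB₁ := 𝓘(ℝ, V)) (IB₂ := I) (F₁ := V) (F₂ := E)
    (E₁ := fun x : V => TangentSpace 𝓘(ℝ, V) x) (E₂ := fun x : M => TangentSpace I x)
    (b₁ := fun _ : M => (0 : V)) (b₂ := fun q : M => α (q, 0))
    (ϕ := fun q => mfderiv 𝓘(ℝ, V) I (fun w => α (q, w)) 0) (v := fun q => φ q) h1 h2
    ((hα.comp (contMDiff_id.prodMk contMDiff_const)) p)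
  refine h3.congr_of_eventuallyEq (Eventually.of_forall fun q => ?_)
  exact (tangentBundle_mk_eq_of_eq (hα0 q) _).symm

/-- The derivative of `f` along the motion field is the derivative of `f` along the motions. -/
theorem mfderiv_motionField {E'' : Type*} [NormedAddCommGroup E''] [NormedSpace ℝ E'']
    {H'' : Type*} [TopologicalSpace H''] {J : ModelWithCorners ℝ E'' H''}
    {N : Type*} [TopologicalSpace N] [ChartedSpace H'' N]
    (hα : ContMDiff (I.prod 𝓘(ℝ, V)) I ∞ α) (hα0 : ∀ p, α (p, 0) = p) (φ : M → V)
    {f : M → N} {p : M} (hf : MDifferentiableAt I J f p) :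
    (mfderiv I J f p (motionField I α φ p) : E'') =
      (mfderiv 𝓘(ℝ, V) J (fun w => f (α (p, w))) 0 : V →L[ℝ] E'') (φ p) := by
  have h := mfderiv_comp_of_eq (x := (0 : V)) (f := fun w => α (p, w)) hf
    ((contMDiff_slice hα p).mdifferentiable (by simp) 0) (hα0 p)
  rw [Function.comp_def] at h
  have hbase : ∀ q, q = p → ∀ e : E, (mfderiv I J f q e : E'') = mfderiv I J f p e := by
    rintro q rfl e
    rfl
  rw [h]
  exact (hbase _ (hα0 p) _).symm

theorem contMDiffAt_fderiv_motion {Q : M → W} {p : M} (hα : ContMDiff (I.prod 𝓘(ℝ, V)) I ∞ α)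
    (hα0 : ∀ p, α (p, 0) = p) [IsManifold I ∞ M] (hQ : ContMDiffAt I 𝓘(ℝ, W) ∞ Q p) :
    ContMDiffAt I 𝓘(ℝ, V →L[ℝ] W) ∞ (fun p => fderiv ℝ (fun w => Q (α (p, w))) 0) p := by
  have h0 : ContMDiffAt (I.prod 𝓘(ℝ, V)) 𝓘(ℝ, W) ∞
      (Function.uncurry fun (p : M) (w : V) => Q (α (p, w))) (p, 0) := by
    refine ContMDiffAt.comp (I' := I) (p, (0 : V)) (g := Q) (f := α) ?_ (hα _)
    rwa [hα0]
  have h1 := ContMDiffAt.mfderiv (x₀ := p) (m := ∞) (fun p w => Q (α (p, w))) (fun _ => (0 : V)) h0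
    contMDiffAt_const (by simp)
  have h2 := inTangentCoordinates_model_space (I := 𝓘(ℝ, V)) (I' := 𝓘(ℝ, W)) (fun _ : M => (0 : V))
    (fun x => Q (α (x, 0))) (fun x => mfderiv 𝓘(ℝ, V) 𝓘(ℝ, W) (fun w => Q (α (x, w))) 0) p
  have h3 := (congrArg (fun f => ContMDiffAt I 𝓘(ℝ, V →L[ℝ] W) ∞ f p) h2).mp h1
  simpa only [mfderiv_eq_fderiv] using h3

end MotionField

section Coordinates

variable {E : Type*} [NormedAddCommGroup E] [NormedSpace ℝ E] [FiniteDimensional ℝ E]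
  {M : Type*} [TopologicalSpace M] [ChartedSpace E M] [IsManifold 𝓘(ℝ, E) ∞ M]

/-- Local coordinates around `p`, cut off so as to be defined on all of the model space. -/
theorem exists_contMDiff_coordinates (p : M) : ∃ γ : E → M, ContMDiff 𝓘(ℝ, E) 𝓘(ℝ, E) ∞ γ ∧
    γ 0 = p ∧ Function.Bijective (mfderiv 𝓘(ℝ, E) 𝓘(ℝ, E) γ 0) := by
  set φ := extChartAt 𝓘(ℝ, E) p with hφ
  obtain ⟨r, hr, hball⟩ := Metric.isOpen_iff.1 (isOpen_extChartAt_target (I := 𝓘(ℝ, E)) p) (φ p)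
    (mem_extChartAt_target p)
  let χ : ContDiffBump (0 : E) := ⟨r / 2, r, half_pos hr, half_lt_self hr⟩
  let s : E → E := fun w => φ p + χ w • w
  have hs : ContDiff ℝ ∞ s := contDiff_const.add (χ.contDiff.smul contDiff_id)
  have hst : ∀ w, s w ∈ φ.target := by
    intro w
    apply hball
    rw [Metric.mem_ball, dist_eq_norm, add_sub_cancel_left, norm_smul, Real.norm_of_nonneg χ.nonneg]
    by_cases hw : w ∈ Metric.ball (0 : E) r
    · rw [mem_ball_zero_iff] at hw
      exact (mul_le_of_le_one_left (norm_nonneg w) χ.le_one).trans_lt hw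
    · have : χ w = 0 := by
        rw [← Function.notMem_support, χ.support_eq]
        exact hw
      rw [this, zero_mul]
      exact hr
  have hγ : ContMDiff 𝓘(ℝ, E) 𝓘(ℝ, E) ∞ (fun w => φ.symm (s w)) := by
    intro w
    exact ((contMDiffOn_extChartAt_symm p).contMDiffAt (extChartAt_target_mem_nhds' (hst w))).comp w
      hs.contMDiff.contMDiffAt
  have hs0 : s 0 = φ p := by simp [s]
  have h0 : φ.symm (s 0) = p := by rw [hs0, extChartAt_to_inv]
  refine ⟨_, hγ, h0, ?_⟩
  -- in the chart the map is a translation near `0`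
  have hφγ : (fun w => φ (φ.symm (s w))) =ᶠ[𝓝 0] fun w => φ p + w := by
    filter_upwards [χ.eventuallyEq_one] with w hw
    rw [φ.right_inv (hst w)]
    simp [s, hw]
  have hd : mfderiv 𝓘(ℝ, E) 𝓘(ℝ, E) (fun w => φ (φ.symm (s w))) 0 = ContinuousLinearMap.id ℝ E := by
    rw [hφγ.mfderiv_eq, mfderiv_eq_fderiv, fderiv_const_add]
    exact fderiv_id
  have hcomp := mfderiv_comp_of_eq (x := (0 : E)) (f := fun w => φ.symm (s w)) (g := φ)
    (mdifferentiableAt_extChartAt (mem_chart_source E p)) (hγ.mdifferentiable (by simp) 0) h0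
  rw [Function.comp_def] at hcomp
  let D : E →L[ℝ] E := mfderiv 𝓘(ℝ, E) 𝓘(ℝ, E) (fun w => φ.symm (s w)) 0
  -- its chart expression has derivative the identity, so `D` has a left inverse
  have hinj : Function.Injective (D : E →ₗ[ℝ] E) := by
    intro a b hab
    have h1 : ∀ v : E, mfderiv 𝓘(ℝ, E) 𝓘(ℝ, E) (fun w => φ (φ.symm (s w))) 0 v = v :=
      fun v => by rw [hd]; rfl
    rw [← h1 a, ← h1 b, hcomp]
    exact congrArg (mfderiv 𝓘(ℝ, E) 𝓘(ℝ, E) φ (φ.symm (s 0))) hab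
  have hsurj : Function.Surjective (D : E →ₗ[ℝ] E) := LinearMap.surjective_of_injective hinj
  exact ⟨hinj, hsurj⟩

end Coordinates

/-! ### Motions along the orbits of a Lie group action -/

section OrbitMotion

variable {E : Type*} [NormedAddCommGroup E] [NormedSpace ℝ E]
  {X : Type*} [TopologicalSpace X] [ChartedSpace E X]
  {E' : Type*} [NormedAddCommGroup E'] [NormedSpace ℝ E'] [FiniteDimensional ℝ E']
  {G : Type*} [TopologicalSpace G] [ChartedSpace E' G] [Group G]
  [MulAction G X]

/-- A smooth family of motions `x ↦ α(x, w)` of `X` along the orbits of `G`, with parameter `w` in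
the Lie algebra and equal to the identity for `w = 0`, whose velocities at `w = 0` span the tangent
spaces of the orbits. -/
structure IsOrbitMotion (G : Type*) [TopologicalSpace G] [ChartedSpace E' G] [Group G]
    [MulAction G X] (α : X × E' → X) : Prop where
  contMDiff : ContMDiff (𝓘(ℝ, E).prod 𝓘(ℝ, E')) 𝓘(ℝ, E) ∞ α
  apply_zero : ∀ x, α (x, 0) = x
  mem_orbit : ∀ x w, α (x, w) ∈ MulAction.orbit G x
  mem_orbitTangent_iff : ∀ x (u : TangentSpace 𝓘(ℝ, E) x), u ∈ orbitTangent (E' := E') G x ↔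
    ∃ w : E', (mfderiv 𝓘(ℝ, E') 𝓘(ℝ, E) (fun w => α (x, w)) 0 : E' →L[ℝ] E) w = (u : E)

omit [FiniteDimensional ℝ E'] in
theorem mem_orbitTangent_iff {x : X} {u : TangentSpace 𝓘(ℝ, E) x} :
    u ∈ orbitTangent (E' := E') G x ↔
      ∃ ξ : E', (mfderiv 𝓘(ℝ, E') 𝓘(ℝ, E) (fun g : G => g • x) 1 : E' →L[ℝ] E) ξ = (u : E) := by
  have h : ∀ e : E, ((⟨(1 : G) • x, e⟩ : TangentBundle 𝓘(ℝ, E) X) = ⟨x, u⟩) ↔ e = (u : E) := by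
    intro e
    rw [tangentBundle_mk_eq_of_eq (I := 𝓘(ℝ, E)) (one_smul G x) e]
    exact Bundle.TotalSpace.mk_inj
  exact exists_congr fun ξ => h _

theorem exists_isOrbitMotion [LieGroup 𝓘(ℝ, E') ∞ G] [ContMDiffSMul 𝓘(ℝ, E') 𝓘(ℝ, E) ∞ G X] :
    ∃ α : X × E' → X, IsOrbitMotion (E := E) G α := by
  have : IsManifold 𝓘(ℝ, E') ∞ G := LieGroup.toContMDiffMul.toIsManifold
  obtain ⟨γ, hγ, hγ0, hγb⟩ := exists_contMDiff_coordinates (E := E') (1 : G)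
  have hact : ContMDiff (𝓘(ℝ, E').prod 𝓘(ℝ, E)) 𝓘(ℝ, E) ∞ (fun q : G × X => q.1 • q.2) :=
    ContMDiffSMul.contMDiff_smul
  refine ⟨fun q => γ q.2 • q.1, ?_, fun x => by simp [hγ0], fun x w => ⟨γ w, rfl⟩, fun x u => ?_⟩
  · exact hact.comp ((hγ.comp contMDiff_snd).prodMk contMDiff_fst)
  · rw [mem_orbitTangent_iff]
    have hs : MDifferentiableAt 𝓘(ℝ, E') 𝓘(ℝ, E) (fun g : G => g • x) 1 :=
      (hact.comp (contMDiff_id.prodMk contMDiff_const)).mdifferentiable (by simp) 1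
    have h := mfderiv_comp_of_eq (x := (0 : E')) (f := γ) hs (hγ.mdifferentiable (by simp) 0) hγ0
    rw [Function.comp_def] at h
    have hbase : ∀ g : G, g = 1 → ∀ e : E',
        (mfderiv 𝓘(ℝ, E') 𝓘(ℝ, E) (fun g : G => g • x) g : E' →L[ℝ] E) e =
          (mfderiv 𝓘(ℝ, E') 𝓘(ℝ, E) (fun g : G => g • x) 1 : E' →L[ℝ] E) e := by
      rintro g rfl e
      rfl
    have h' : ∀ w : E', (mfderiv 𝓘(ℝ, E') 𝓘(ℝ, E) (fun w => γ w • x) 0 : E' →L[ℝ] E) w =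
        (mfderiv 𝓘(ℝ, E') 𝓘(ℝ, E) (fun g : G => g • x) 1 : E' →L[ℝ] E)
          ((mfderiv 𝓘(ℝ, E') 𝓘(ℝ, E') γ 0 : E' →L[ℝ] E') w) := by
      intro w
      rw [h]
      exact hbase _ hγ0 _
    constructor
    · rintro ⟨ξ, hξ⟩
      obtain ⟨w, hw⟩ := hγb.2 ξ
      exact ⟨w, (h' w).trans ((congrArg _ hw).trans hξ)⟩
    · rintro ⟨w, hw⟩
      exact ⟨_, (h' w).symm.trans hw⟩

end OrbitMotion

section OrbitPreserving

variable {E : Type*} [NormedAddCommGroup E] [NormedSpace ℝ E]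
  {X : Type*} [TopologicalSpace X] [ChartedSpace E X]
  {G : Type*} [Group G] [MulAction G X]

theorem OrbitPreserving.trans {Φ Ψ : X ≃ₘ^∞⟮𝓘(ℝ, E), 𝓘(ℝ, E)⟯ X} (hΦ : OrbitPreserving G Φ)
    (hΨ : OrbitPreserving G Ψ) : OrbitPreserving G (Φ.trans Ψ) := by
  intro y
  rw [Diffeomorph.coe_trans, image_comp, hΦ, hΨ]

theorem OrbitPreserving.symm {Φ : X ≃ₘ^∞⟮𝓘(ℝ, E), 𝓘(ℝ, E)⟯ X} (hΦ : OrbitPreserving G Φ) :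
    OrbitPreserving G Φ.symm := by
  intro y
  conv_lhs => rw [← hΦ y]
  exact Φ.symm_image_image _

/-- Being related by an orbit-preserving diffeomorphism is an equivalence relation, so that it
suffices to know it locally in a connected set of parameters. -/
theorem exists_orbitPreserving_of_isPreconnected {Z : Type*} [TopologicalSpace Z] {D : Set Z}
    (hD : IsPreconnected D) {S : Z → Set X}
    (h : ∀ z ∈ D, ∀ᶠ z' in 𝓝 z, ∃ Φ : X ≃ₘ^∞⟮𝓘(ℝ, E), 𝓘(ℝ, E)⟯ X,
      OrbitPreserving G Φ ∧ Φ '' S z = S z') {z z' : Z} (hz : z ∈ D) (hz' : z' ∈ D) :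
    ∃ Φ : X ≃ₘ^∞⟮𝓘(ℝ, E), 𝓘(ℝ, E)⟯ X, OrbitPreserving G Φ ∧ Φ '' S z = S z' := by
  refine hD.induction₂ (fun z z' => ∃ Φ : X ≃ₘ^∞⟮𝓘(ℝ, E), 𝓘(ℝ, E)⟯ X,
    OrbitPreserving G Φ ∧ Φ '' S z = S z') (fun z hz => nhdsWithin_le_nhds (h z hz)) ?_ ?_ hz hz'
  · rintro z₁ z₂ z₃ - - - ⟨Φ, hΦ, hΦS⟩ ⟨Ψ, hΨ, hΨS⟩
    exact ⟨Φ.trans Ψ, hΦ.trans hΨ, by rw [Diffeomorph.coe_trans, image_comp, hΦS, hΨS]⟩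
  · rintro z₁ z₂ - - ⟨Φ, hΦ, hΦS⟩
    exact ⟨Φ.symm, hΦ.symm, by rw [← hΦS]; exact Φ.symm_image_image _⟩

end OrbitPreserving

/-! ### Level sets of a function -/

section LevelSets

variable {E : Type*} [NormedAddCommGroup E] [NormedSpace ℝ E] [FiniteDimensional ℝ E]
  {X : Type*} [TopologicalSpace X] [ChartedSpace E X] [IsManifold 𝓘(ℝ, E) ∞ X]
  [T2Space X]
  {E' : Type*} [NormedAddCommGroup E'] [NormedSpace ℝ E'] [FiniteDimensional ℝ E']
  {G : Type*} [TopologicalSpace G] [ChartedSpace E' G] [Group G]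
  [MulAction G X] {α : X × E' → X} {f : X → ℝ}

omit [FiniteDimensional ℝ E] [IsManifold 𝓘(ℝ, E) ∞ X] [T2Space X] [FiniteDimensional ℝ E'] in
theorem LevelSetTransverseToOrbit.exists_fderiv_ne_zero (hα : IsOrbitMotion (E := E) G α)
    (hf : ContMDiff 𝓘(ℝ, E) 𝓘(ℝ, ℝ) ∞ f) {x : X}
    (h : LevelSetTransverseToOrbit (E := E) (E' := E') G f (f x) x) :
    ∃ w : E', fderiv ℝ (fun w => f (α (x, w))) 0 w ≠ 0 := by
  obtain ⟨hne, hsum⟩ := h x ⟨rfl, MulAction.mem_orbit_self x⟩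
  by_contra! hcon
  refine hne (ContinuousLinearMap.ext fun v => ?_)
  obtain ⟨u, hu, ξ, hξ, rfl⟩ := hsum v
  obtain ⟨w, hw⟩ := (hα.mem_orbitTangent_iff x ξ).1 hξ
  have h1 := mfderiv_motionField hα.contMDiff hα.apply_zero (fun _ => w)
    (hf.mdifferentiable (by simp) x)
  have h2 : motionField 𝓘(ℝ, E) α (fun _ => w) x = ξ := hw
  rw [h2] at h1
  rw [map_add, hu]
  refine (zero_add _).trans (h1.trans ?_)
  rw [mfderiv_eq_fderiv]
  exact hcon w

omit [FiniteDimensional ℝ E'] in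
/-- A vector field tangent to the orbits along which `f` grows with speed `1`: locally it is the velocity
of a motion in a fixed direction `w`, rescaled, and these pieces are glued by a partition
of unity. -/
theorem exists_vectorField_levelSets [SecondCountableTopology X] (hα : IsOrbitMotion (E := E) G α)
    {Y : Set X} {a b : ℝ} (hY : IsCompact (closure Y)) (hf : ContMDiff 𝓘(ℝ, E) 𝓘(ℝ, ℝ) ∞ f)
    (htr : ∀ c ∈ Icc a b, ∀ y ∈ closure Y,
      LevelSetTransverseToOrbit (E := E) (E' := E') G f c y) :
    ∃ v : ∀ x : X, TangentSpace 𝓘(ℝ, E) x,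
      IsSmoothVectorField 𝓘(ℝ, E) v ∧ HasCompactSupportField 𝓘(ℝ, E) v ∧
      (∀ y ∈ Y, v y ∈ orbitTangent (E' := E') G y) ∧
      (∀ y ∈ Y, f y ∈ Icc a b → lieDerivFun 𝓘(ℝ, E) v f y = 1) := by
  have : LocallyCompactSpace X := ChartedSpace.locallyCompactSpace E X
  let A : X → E' →L[ℝ] ℝ := fun x => fderiv ℝ (fun w => f (α (x, w))) 0
  have hA : ContMDiff 𝓘(ℝ, E) 𝓘(ℝ, E' →L[ℝ] ℝ) ∞ A := fun x =>
    contMDiffAt_fderiv_motion hα.contMDiff hα.apply_zero (hf x)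
  set K : Set X := closure Y ∩ f ⁻¹' Icc a b with hK
  have hKc : IsCompact K := hY.inter_right (isClosed_Icc.preimage hf.continuous)
  obtain ⟨K', hK', hKK'⟩ := exists_compact_superset hKc
  obtain ⟨φ, hφ⟩ := exists_contMDiffMap_forall_mem_convex_of_local 𝓘(ℝ, E) (n := ⊤)
    (t := fun x => {w : E' | (x ∈ K → A x w = 1) ∧ (x ∉ K' → w = 0)}) (by
      intro x w hw w' hw' s t _ _ hst
      refine ⟨fun hx => ?_, fun hx => ?_⟩
      · rw [map_add, map_smul, map_smul, hw.1 hx, hw'.1 hx, smul_eq_mul, smul_eq_mul, mul_one,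
          mul_one, hst]
      · rw [hw.2 hx, hw'.2 hx, smul_zero, smul_zero, add_zero]) (by
      intro x
      by_cases hx : x ∈ K
      · obtain ⟨w, hw⟩ := (htr (f x) hx.2 x hx.1).exists_fderiv_ne_zero hα hf
        have hAw : ContMDiff 𝓘(ℝ, E) 𝓘(ℝ, ℝ) ∞ (fun y => A y w) := hA.clm_apply contMDiff_const
        have hne : ∀ᶠ y in 𝓝 x, A y w ≠ 0 := hAw.continuous.continuousAt.eventually_ne hw
        refine ⟨_, inter_mem hne (mem_interior_iff_mem_nhds.1 (hKK' hx)),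
          fun y => (A y w)⁻¹ • w, fun y hy => ?_, fun y hy => ⟨fun _ => ?_, fun h => absurd hy.2 h⟩⟩
        · exact (((contDiffAt_inv ℝ hy.1).contMDiffAt.comp y (hAw y)).smul
            contMDiffAt_const).contMDiffWithinAt
        · rw [map_smul, smul_eq_mul, inv_mul_cancel₀ hy.1]
      · exact ⟨_, hKc.isClosed.isOpen_compl.mem_nhds hx, fun _ => 0, contMDiffOn_const,
          fun y hy => ⟨fun h => absurd h hy, fun _ => rfl⟩⟩)
  refine ⟨motionField 𝓘(ℝ, E) α φ,
    isSmoothVectorField_motionField hα.contMDiff hα.apply_zero φ.contMDiff, ?_, ?_, ?_⟩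
  · refine hK'.of_isClosed_subset isClosed_closure (closure_minimal (fun x hx => ?_) hK'.isClosed)
    by_contra hxK
    exact hx (motionField_eq_zero ((hφ x).2 hxK))
  · exact fun y _ => (hα.mem_orbitTangent_iff y _).2 ⟨φ y, rfl⟩
  · intro y hy hfy
    refine (mfderiv_motionField hα.contMDiff hα.apply_zero φ
      (hf.mdifferentiable (by simp) y)).trans ?_
    rw [mfderiv_eq_fderiv]
    exact (hφ y).1 ⟨subset_closure hy, hfy⟩

theorem exists_orbitPreserving_levelSets (hα : IsOrbitMotion (E := E) G α)
    {Y : Set X} {a b : ℝ} (hYG : ∀ g : G, ∀ y ∈ Y, g • y ∈ Y) (hY : IsCompact (closure Y))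
    (hf : ContMDiff 𝓘(ℝ, E) 𝓘(ℝ, ℝ) ∞ f)
    (htr : ∀ c ∈ Icc a b, ∀ y ∈ closure Y,
      LevelSetTransverseToOrbit (E := E) (E' := E') G f c y)
    {c₁ c₂ : ℝ} (hc₁ : c₁ ∈ Icc a b) (hc₂ : c₂ ∈ Icc a b) :
    ∃ Φ : X ≃ₘ^∞⟮𝓘(ℝ, E), 𝓘(ℝ, E)⟯ X,
      OrbitPreserving G Φ ∧ Φ '' (f ⁻¹' {c₁} ∩ Y) = f ⁻¹' {c₂} ∩ Y := by
  refine exists_orbitPreserving_of_isPreconnected (S := fun c => f ⁻¹' {c} ∩ Y)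
    isPreconnected_Icc (fun c hc => ?_) hc₁ hc₂
  refine eventually_exists_orbitPreserving (N := fun c => f ⁻¹' {c}) (W := ℝ) hα.contMDiff
    hα.apply_zero hα.mem_orbit hYG hY fun p hp => ?_
  have hQ : ContMDiff (𝓘(ℝ, E).prod 𝓘(ℝ, ℝ)) 𝓘(ℝ, ℝ) ∞ (fun q : X × ℝ => f q.1 - q.2) :=
    (hf.comp contMDiff_fst).sub contMDiff_snd
  by_cases hfp : f p = c
  · subst hfp
    refine Or.inr ⟨fun q => f q.1 - q.2, Eventually.of_forall fun q => hQ q,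
      Eventually.of_forall fun q => sub_eq_zero.symm, ?_⟩
    obtain ⟨w, hw⟩ := (htr (f p) hc p hp).exists_fderiv_ne_zero hα hf
    simp only [fderiv_sub_const]
    exact fun r => ⟨(r / fderiv ℝ (fun w => f (α (p, w))) 0 w) • w, by
      rw [map_smul, smul_eq_mul, div_mul_cancel₀ _ hw]⟩
  · left
    have : ∀ᶠ q : X × ℝ in 𝓝 (p, c), f q.1 - q.2 ≠ 0 :=
      hQ.continuous.continuousAt.eventually_ne (sub_ne_zero.2 hfp)
    exact this.mono fun q hq h => hq (sub_eq_zero.2 h)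

end LevelSets

/-! ### Tangent vectors to subsets given by equations -/

section TangentVectors

variable {E : Type*} [NormedAddCommGroup E] [NormedSpace ℝ E]
  {H : Type*} [TopologicalSpace H] {I : ModelWithCorners ℝ E H}
  {M : Type*} [TopologicalSpace M] [ChartedSpace H M]
  {W : Type*} [NormedAddCommGroup W] [NormedSpace ℝ W]
  {F : Type*} [NormedAddCommGroup F] [NormedSpace ℝ F]

theorem mfderiv_eq_zero_of_mem_tangentVectors {S : Set M} {Q : M → W} {q : M}
    {u : TangentSpace I q} (hu : u ∈ tangentVectors I S q) (hQ : MDifferentiableAt I 𝓘(ℝ, W) Q q)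
    (hS : ∀ᶠ x in 𝓝 q, x ∈ S → Q x = 0) : (mfderiv I 𝓘(ℝ, W) Q q u : W) = 0 := by
  obtain ⟨γ, hγ, hγS, hγq⟩ := hu
  obtain rfl : γ 0 = q := congrArg Bundle.TotalSpace.proj hγq
  obtain rfl := Bundle.TotalSpace.mk_inj.1 hγq
  have h0 : (fun t => Q (γ t)) =ᶠ[𝓝 0] fun _ => 0 := by
    filter_upwards [hγS, hγ.continuousAt.eventually hS] with t h1 h2 using h2 h1
  have h1 := mfderiv_comp (I := 𝓘(ℝ, ℝ)) (0 : ℝ) hQ (hγ.mdifferentiableAt (by simp))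
  rw [Function.comp_def, h0.mfderiv_eq, mfderiv_const] at h1
  exact (congrArg (fun L : ℝ →L[ℝ] W => L 1) h1).symm

/-- In coordinates `T` with inverse `T'`, a subset given by a linear equation `ℓ = 0` has the kernel
of the derivative of `ℓ ∘ T` as its tangent space: it contains the image under `T'` of the straight
line in each direction of this kernel. -/
theorem tangentVectors_eq_ker {S : Set M} {T : M → F} {T' : F → M} {ℓ : F →L[ℝ] W} {q : M}
    (hT : ContMDiffAt I 𝓘(ℝ, F) ∞ T q) (hT' : ContMDiffAt 𝓘(ℝ, F) I ∞ T' (T q))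
    (hT'T : ∀ᶠ x in 𝓝 q, T' (T x) = x) (hTT' : ∀ᶠ y in 𝓝 (T q), T (T' y) = y)
    (hS : ∀ᶠ x in 𝓝 q, x ∈ S ↔ ℓ (T x) = 0) (hq : q ∈ S) :
    tangentVectors I S q = {v | (mfderiv I 𝓘(ℝ, W) (fun x => ℓ (T x)) q v : W) = 0} := by
  have hTd := hT.mdifferentiableAt (by simp)
  have hℓ : ContMDiff 𝓘(ℝ, F) 𝓘(ℝ, W) ∞ ℓ := ℓ.contMDiff
  have hq' : T' (T q) = q := hT'T.self_of_nhds
  have hchain : ∀ v : TangentSpace I q, (mfderiv I 𝓘(ℝ, W) (fun x => ℓ (T x)) q v : W) =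
      ℓ (mfderiv I 𝓘(ℝ, F) T q v : F) := by
    intro v
    have h := mfderiv_comp q (hℓ.mdifferentiable (by simp) (T q)) hTd
    rw [Function.comp_def, mfderiv_eq_fderiv, ℓ.fderiv] at h
    rw [h]
    rfl
  refine Subset.antisymm (fun u hu => ?_) (fun v hv => ?_)
  · exact mfderiv_eq_zero_of_mem_tangentVectors hu
      ((hℓ.contMDiffAt.comp q hT).mdifferentiableAt (by simp)) (hS.mono fun x hx => hx.1)
  · set s : F := mfderiv I 𝓘(ℝ, F) T q v with hs
    have hℓs : ℓ s = 0 := (hchain v).symm.trans hv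
    let c : ℝ → F := fun t => T q + t • s
    have hc : ContDiff ℝ ∞ c := contDiff_const.add (contDiff_id.smul contDiff_const)
    have hc0 : c 0 = T q := by simp [c]
    have hct : Tendsto c (𝓝 0) (𝓝 (T q)) := hc0 ▸ hc.continuous.tendsto 0
    have hT'c : ContMDiffAt 𝓘(ℝ, F) I ∞ T' (c 0) := hc0.symm ▸ hT'
    have hT't : Tendsto T' (𝓝 (T q)) (𝓝 q) := by
      have := hT'.continuousAt
      rwa [ContinuousAt, hq'] at this
    refine ⟨fun t => T' (c t), hT'c.comp 0 hc.contMDiff.contMDiffAt, ?_, ?_⟩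
    · filter_upwards [hct.eventually hTT', (hT't.comp hct).eventually hS] with t h1 h2
      refine h2.2 ?_
      have h3 : ℓ (T q) = 0 := hS.self_of_nhds.1 hq
      simp only [Function.comp_apply, h1]
      simp [c, h3, hℓs]
    · have hbase : ∀ y : F, y = T q → ∀ e : F, (mfderiv 𝓘(ℝ, F) I T' y e : E) =
          (mfderiv 𝓘(ℝ, F) I T' (T q) e : E) := by
        rintro y rfl e
        rfl
      have h1 := mfderiv_comp (0 : ℝ) (hT'c.mdifferentiableAt (by simp))
        (hc.contMDiff.mdifferentiable (n := ∞) (by simp) 0)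
      rw [Function.comp_def] at h1
      have h2 : (mfderiv 𝓘(ℝ, ℝ) 𝓘(ℝ, F) c 0 (1 : ℝ) : F) = s := by
        have h3 : HasDerivAt c ((1 : ℝ) • s) 0 := ((hasDerivAt_id 0).smul_const s).const_add (T q)
        rw [mfderiv_eq_fderiv]
        exact h3.deriv.trans (one_smul ℝ s)
      have h4 := mfderiv_comp q (hT'.mdifferentiableAt (by simp)) hTd
      have h5 : T' ∘ T =ᶠ[𝓝 q] id := hT'T
      rw [h5.mfderiv_eq, mfderiv_id] at h4
      have h6 : (mfderiv 𝓘(ℝ, ℝ) I (fun t => T' (c t)) 0 (1 : ℝ) : E) = (v : E) := by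
        rw [h1]
        refine (hbase _ hc0 _).trans ?_
        refine (congrArg (mfderiv 𝓘(ℝ, F) I T' (T q)) h2).trans ?_
        exact (congrArg (fun L : E →L[ℝ] E => L v) h4).symm
      refine (tangentBundle_mk_eq_of_eq (I := I) (p := q) ?_ _).trans ?_
      · exact (congrArg T' hc0).trans hq'
      · exact congrArg _ h6

end TangentVectors

/-! ### Families of submanifolds -/

section Family

variable {E : Type*} [NormedAddCommGroup E] [NormedSpace ℝ E] [FiniteDimensional ℝ E]
  {X : Type*} [TopologicalSpace X] [ChartedSpace E X] [IsManifold 𝓘(ℝ, E) ∞ X]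
  {k : ℕ} {F : X × (Fin k → ℝ) → X} {M : Set X}

/-- The total map `(x, z) ↦ (F(x, z), z)` of a smooth family of diffeomorphisms is a
diffeomorphism. -/
theorem exists_totalDiffeomorph
    (hF : ContMDiff (𝓘(ℝ, E).prod 𝓘(ℝ, Fin k → ℝ)) 𝓘(ℝ, E) ∞ F)
    (hFz : ∀ z : Fin k → ℝ, ∃ φ : X ≃ₘ^∞⟮𝓘(ℝ, E), 𝓘(ℝ, E)⟯ X, ∀ x, φ x = F (x, z)) :
    ∃ Θ : (X × (Fin k → ℝ)) ≃ₘ^∞⟮𝓘(ℝ, E).prod 𝓘(ℝ, Fin k → ℝ), 𝓘(ℝ, E).prod 𝓘(ℝ, Fin k → ℝ)⟯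
      (X × (Fin k → ℝ)), ∀ q, Θ q = (F q, q.2) := by
  have hloc : IsLocalDiffeomorph (𝓘(ℝ, E).prod 𝓘(ℝ, Fin k → ℝ)) (𝓘(ℝ, E).prod 𝓘(ℝ, Fin k → ℝ)) ∞
      (fun q : X × (Fin k → ℝ) => (F q, q.2)) := by
    rintro ⟨x, z⟩
    refine isLocalDiffeomorphAt_fibred (Eventually.of_forall fun q => hF q) ?_
    obtain ⟨φ, hφ⟩ := hFz z
    rw [show (fun x => F (x, z)) = φ from funext fun x => (hφ x).symm]
    exact (φ.mfderivToContinuousLinearEquiv (by simp) x).bijective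
  refine ⟨hloc.diffeomorphOfBijective ⟨?_, ?_⟩, fun q => rfl⟩
  · rintro ⟨x, z⟩ ⟨x', z'⟩ h
    obtain ⟨h1, h2⟩ := Prod.ext_iff.1 h
    dsimp only at h1 h2
    subst h2
    obtain ⟨φ, hφ⟩ := hFz z
    rw [← hφ, ← hφ] at h1
    rw [φ.injective h1]
  · rintro ⟨y, z⟩
    obtain ⟨φ, hφ⟩ := hFz z
    exact ⟨(φ.symm y, z), Prod.ext ((hφ _).symm.trans (φ.apply_symm_apply y)) rfl⟩

omit [FiniteDimensional ℝ E] [IsManifold 𝓘(ℝ, E) ∞ X] [TopologicalSpace X] [ChartedSpace E X] in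
theorem mem_familyMember_iff {x : X} {z : Fin k → ℝ} :
    x ∈ familyMember F M z ↔ (x, z) ∈ familyTotal F M := by
  constructor
  · rintro ⟨m, hm, rfl⟩
    exact ⟨(m, z), ⟨hm, mem_univ _⟩, rfl⟩
  · rintro ⟨⟨m, z'⟩, ⟨hm, -⟩, h⟩
    obtain ⟨h1, h2⟩ := Prod.ext_iff.1 h
    dsimp only at h1 h2
    subst h2
    exact ⟨m, hm, h1⟩

variable {Θ : (X × (Fin k → ℝ)) ≃ₘ^∞⟮𝓘(ℝ, E).prod 𝓘(ℝ, Fin k → ℝ),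
  𝓘(ℝ, E).prod 𝓘(ℝ, Fin k → ℝ)⟯ (X × (Fin k → ℝ))}

omit [FiniteDimensional ℝ E] [IsManifold 𝓘(ℝ, E) ∞ X] in
theorem mem_familyTotal_iff (hΘ : ∀ q, Θ q = (F q, q.2)) {q : X × (Fin k → ℝ)} :
    q ∈ familyTotal F M ↔ (Θ.symm q).1 ∈ M := by
  constructor
  · rintro ⟨p, ⟨hp, -⟩, rfl⟩
    change (Θ.symm (F p, p.2)).1 ∈ M
    rwa [← hΘ, Θ.symm_apply_apply]
  · intro h
    refine ⟨Θ.symm q, ⟨h, mem_univ _⟩, ?_⟩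
    exact (hΘ _).symm.trans (Θ.apply_symm_apply q)

omit [FiniteDimensional ℝ E] [IsManifold 𝓘(ℝ, E) ∞ X] in
theorem isClosed_familyTotal (hΘ : ∀ q, Θ q = (F q, q.2)) (hM : IsClosed M) :
    IsClosed (familyTotal F M) := by
  have : familyTotal F M = (fun q => (Θ.symm q).1) ⁻¹' M :=
    ext fun q => mem_familyTotal_iff hΘ
  rw [this]
  exact hM.preimage (continuous_fst.comp Θ.symm.continuous)

omit [IsManifold 𝓘(ℝ, E) ∞ X] in
/-- A submanifold of codimension `k` is defined, in a suitable chart, by a linear equation with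
values in `ℝᵏ`. -/
theorem IsSubmanifoldOfCodim.exists_chart (hM : IsSubmanifoldOfCodim (E := E) k M) {p : X}
    (hp : p ∈ M) : ∃ φ ∈ IsManifold.maximalAtlas 𝓘(ℝ, E) ∞ X, p ∈ φ.source ∧
      ∃ π : E →L[ℝ] (Fin k → ℝ), Function.Surjective π ∧ ∀ q ∈ φ.source, q ∈ M ↔ π (φ q) = 0 := by
  obtain ⟨φ, hφ, hpφ, S, hS, hSM⟩ := hM p hp
  have hrank : Module.finrank ℝ (E ⧸ S) = Module.finrank ℝ (Fin k → ℝ) := by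
    have := S.finrank_quotient_add_finrank
    rw [Module.finrank_fin_fun]
    omega
  let e : (E ⧸ S) ≃ₗ[ℝ] (Fin k → ℝ) := LinearEquiv.ofFinrankEq _ _ hrank
  refine ⟨φ, hφ, hpφ, (e.toLinearMap ∘ₗ S.mkQ).toContinuousLinearMap,
    e.surjective.comp S.mkQ_surjective, fun q hq => ?_⟩
  rw [hSM q hq]
  change φ q ∈ S ↔ e (S.mkQ (φ q)) = 0
  rw [e.map_eq_zero_iff, Submodule.mkQ_apply, Submodule.Quotient.mk_eq_zero]

omit [IsManifold 𝓘(ℝ, E) ∞ X] in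
/-- The total space of the family has around each of its points a smooth defining function `Q`,
whose kernels are its tangent spaces, and which is a submersion already on the slices
`X × {z}`. -/
theorem exists_definingFunction_familyTotal (hΘ : ∀ q, Θ q = (F q, q.2))
    (hM : IsSubmanifoldOfCodim (E := E) k M) {x₀ : X} {z₀ : Fin k → ℝ}
    (h₀ : (x₀, z₀) ∈ familyTotal F M) :
    ∃ Q : X × (Fin k → ℝ) → (Fin k → ℝ),
      (∀ᶠ q in 𝓝 (x₀, z₀),
        ContMDiffAt (𝓘(ℝ, E).prod 𝓘(ℝ, Fin k → ℝ)) 𝓘(ℝ, Fin k → ℝ) ∞ Q q) ∧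
      (∀ᶠ q in 𝓝 (x₀, z₀), q ∈ familyTotal F M ↔ Q q = 0) ∧
      (∀ᶠ q in 𝓝 (x₀, z₀), q ∈ familyTotal F M →
        tangentVectors (𝓘(ℝ, E).prod 𝓘(ℝ, Fin k → ℝ)) (familyTotal F M) q =
          {v | (mfderiv (𝓘(ℝ, E).prod 𝓘(ℝ, Fin k → ℝ)) 𝓘(ℝ, Fin k → ℝ) Q q v : Fin k → ℝ) = 0}) ∧
      Function.Surjective (mfderiv 𝓘(ℝ, E) 𝓘(ℝ, Fin k → ℝ) (fun x => Q (x, z₀)) x₀) := by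
  obtain ⟨φ, hφ, hpφ, π, hπ, hπM⟩ := hM.exists_chart ((mem_familyTotal_iff hΘ).1 h₀)
  let T : X × (Fin k → ℝ) → E × (Fin k → ℝ) := fun q => (φ (Θ.symm q).1, (Θ.symm q).2)
  let T' : E × (Fin k → ℝ) → X × (Fin k → ℝ) := fun y => Θ (φ.symm y.1, y.2)
  let U : Set (X × (Fin k → ℝ)) := {q | (Θ.symm q).1 ∈ φ.source}
  have hfst : ContMDiff (𝓘(ℝ, E).prod 𝓘(ℝ, Fin k → ℝ)) 𝓘(ℝ, E) ∞ (fun q => (Θ.symm q).1) :=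
    contMDiff_fst.comp Θ.symm.contMDiff
  have hU : IsOpen U := φ.open_source.preimage hfst.continuous
  have hT : ∀ q ∈ U, ContMDiffAt (𝓘(ℝ, E).prod 𝓘(ℝ, Fin k → ℝ)) 𝓘(ℝ, E × (Fin k → ℝ)) ∞ T q :=
    fun q hq => ((contMDiffAt_of_mem_maximalAtlas hφ hq).comp q (hfst q)).prodMk_space
      ((contMDiff_snd.comp Θ.symm.contMDiff) q)
  have hT' : ∀ y : E × (Fin k → ℝ), y.1 ∈ φ.target →
      ContMDiffAt 𝓘(ℝ, E × (Fin k → ℝ)) (𝓘(ℝ, E).prod 𝓘(ℝ, Fin k → ℝ)) ∞ T' y := by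
    intro y hy
    refine (Θ.contMDiff _).comp y (ContMDiffAt.prodMk ?_ contDiff_snd.contMDiff.contMDiffAt)
    exact (contMDiffAt_symm_of_mem_maximalAtlas hφ hy).comp y contDiff_fst.contMDiff.contMDiffAt
  have hT'T : ∀ q ∈ U, T' (T q) = q := by
    intro q hq
    change Θ (φ.symm (φ (Θ.symm q).1), (Θ.symm q).2) = q
    rw [φ.left_inv hq]
    exact Θ.apply_symm_apply q
  have hTT' : ∀ y : E × (Fin k → ℝ), y.1 ∈ φ.target → T (T' y) = y := by
    intro y hy
    change (φ (Θ.symm (Θ (φ.symm y.1, y.2))).1, (Θ.symm (Θ (φ.symm y.1, y.2))).2) = y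
    rw [Θ.symm_apply_apply]
    exact Prod.ext (φ.right_inv hy) rfl
  let ℓ : (E × (Fin k → ℝ)) →L[ℝ] (Fin k → ℝ) := π.comp (ContinuousLinearMap.fst ℝ E (Fin k → ℝ))
  have hmem : ∀ q ∈ U, q ∈ familyTotal F M ↔ ℓ (T q) = 0 := fun q hq =>
    (mem_familyTotal_iff hΘ).trans (hπM _ hq)
  have hQ : ∀ q ∈ U, ContMDiffAt (𝓘(ℝ, E).prod 𝓘(ℝ, Fin k → ℝ)) 𝓘(ℝ, Fin k → ℝ) ∞
      (fun q => ℓ (T q)) q := fun q hq => ℓ.contMDiff.contMDiffAt.comp q (hT q hq)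
  have hev : ∀ᶠ q in 𝓝 (x₀, z₀), q ∈ U := hU.mem_nhds hpφ
  refine ⟨fun q => ℓ (T q), hev.mono hQ, hev.mono hmem, hev.mono fun q hq hqM => ?_, ?_⟩
  · refine tangentVectors_eq_ker (hT q hq) (hT' _ (φ.map_source hq))
      ((hU.eventually_mem hq).mono hT'T) ?_
      ((hU.eventually_mem hq).mono hmem) hqM
    have : ∀ᶠ y : E × (Fin k → ℝ) in 𝓝 (T q), y.1 ∈ φ.target :=
      continuous_fst.continuousAt.eventually_mem (φ.open_target.mem_nhds (φ.map_source hq))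
    exact this.mono hTT'
  · -- on the slice, `Q` is `π` in the coordinates `e ↦ F(φ⁻¹ e, z₀)`
    set e₀ : E := φ (Θ.symm (x₀, z₀)).1 with he₀
    have he₀t : e₀ ∈ φ.target := φ.map_source hpφ
    have hsnd : (Θ.symm (x₀, z₀)).2 = z₀ := by
      have h1 := hΘ (Θ.symm (x₀, z₀))
      have h2 : Θ (Θ.symm (x₀, z₀)) = (x₀, z₀) := Θ.apply_symm_apply _
      rw [h2] at h1
      exact (congrArg Prod.snd h1).symm
    let σ : E → X := fun e => (T' (e, z₀)).1
    have hσs : ∀ e, T' (e, z₀) = (σ e, z₀) := fun e =>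
      Prod.ext rfl (show (Θ (φ.symm e, z₀)).2 = z₀ by rw [hΘ])
    have hσ : ContMDiffAt 𝓘(ℝ, E) 𝓘(ℝ, E) ∞ σ e₀ :=
      contMDiffAt_fst.comp e₀ (ContMDiffAt.comp (I' := 𝓘(ℝ, E × (Fin k → ℝ))) e₀
        (f := fun e => (e, z₀)) (hT' (e₀, z₀) he₀t)
        (contMDiffAt_id.prodMk_space contMDiffAt_const))
    have hσ0 : σ e₀ = x₀ := by
      have h1 : T' (e₀, z₀) = (x₀, z₀) := by
        have := hT'T (x₀, z₀) hpφ
        rwa [show T (x₀, z₀) = (e₀, z₀) from Prod.ext rfl hsnd] at this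
      exact congrArg Prod.fst h1
    have hπσ : (fun e => ℓ (T (σ e, z₀))) =ᶠ[𝓝 e₀] π := by
      filter_upwards [φ.open_target.mem_nhds he₀t] with e he
      rw [← hσs, hTT' _ he]
      rfl
    have hs : MDifferentiableAt 𝓘(ℝ, E) 𝓘(ℝ, Fin k → ℝ) (fun x => ℓ (T (x, z₀))) x₀ :=
      ((hQ (x₀, z₀) hpφ).comp x₀ (f := fun x => (x, z₀))
        (contMDiffAt_id.prodMk contMDiffAt_const)).mdifferentiableAt (by simp)
    have h := mfderiv_comp_of_eq (x := e₀) (f := σ) hs (hσ.mdifferentiableAt (by simp)) hσ0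
    rw [Function.comp_def, hπσ.mfderiv_eq, mfderiv_eq_fderiv, π.fderiv] at h
    have hbase : ∀ y, y = x₀ → ∀ e : E,
        (mfderiv 𝓘(ℝ, E) 𝓘(ℝ, Fin k → ℝ) (fun x => ℓ (T (x, z₀))) y e : Fin k → ℝ) =
          mfderiv 𝓘(ℝ, E) 𝓘(ℝ, Fin k → ℝ) (fun x => ℓ (T (x, z₀))) x₀ e := by
      rintro y rfl e
      rfl
    intro c
    obtain ⟨e, he⟩ := hπ c
    refine ⟨(mfderiv 𝓘(ℝ, E) 𝓘(ℝ, E) σ e₀ e : E), ?_⟩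
    exact (hbase _ hσ0 _).symm.trans ((congrArg (fun L : E →L[ℝ] (Fin k → ℝ) => L e) h).symm.trans he)

end Family

section FamilyIsotopy

variable {E : Type*} [NormedAddCommGroup E] [NormedSpace ℝ E] [FiniteDimensional ℝ E]
  {X : Type*} [TopologicalSpace X] [ChartedSpace E X] [IsManifold 𝓘(ℝ, E) ∞ X]
  {E' : Type*} [NormedAddCommGroup E'] [NormedSpace ℝ E'] [FiniteDimensional ℝ E']
  {G : Type*} [TopologicalSpace G] [ChartedSpace E' G] [Group G]
  [MulAction G X] {α : X × E' → X}
  {k : ℕ} {F : X × (Fin k → ℝ) → X} {M Y : Set X} {a b : Fin k → ℝ}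

omit [FiniteDimensional ℝ E] [IsManifold 𝓘(ℝ, E) ∞ X] [FiniteDimensional ℝ E'] in
/-- If a submersion vanishes on a submanifold transverse to an orbit, it remains a submersion when
restricted to the orbit. -/
theorem TransverseToOrbit.surjective_fderiv (hα : IsOrbitMotion (E := E) G α) {N : Set X} {x : X}
    (hN : TransverseToOrbit (E := E) (E' := E') G N x) (hx : x ∈ N)
    {W : Type*} [NormedAddCommGroup W] [NormedSpace ℝ W] {f : X → W}
    (hf : MDifferentiableAt 𝓘(ℝ, E) 𝓘(ℝ, W) f x) (hfN : ∀ᶠ y in 𝓝 x, y ∈ N → f y = 0)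
    (hs : Function.Surjective (mfderiv 𝓘(ℝ, E) 𝓘(ℝ, W) f x)) :
    Function.Surjective (fderiv ℝ (fun w => f (α (x, w))) 0) := by
  intro c
  obtain ⟨v, hv⟩ := hs c
  obtain ⟨u, hu, ξ, hξ, rfl⟩ := hN x ⟨hx, MulAction.mem_orbit_self x⟩ v
  obtain ⟨w, hw⟩ := (hα.mem_orbitTangent_iff x ξ).1 hξ
  have h1 := mfderiv_motionField hα.contMDiff hα.apply_zero (fun _ => w) hf
  have h2 : motionField 𝓘(ℝ, E) α (fun _ => w) x = ξ := hw
  rw [h2, mfderiv_eq_fderiv] at h1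
  rw [map_add] at hv
  refine ⟨w, h1.symm.trans (Eq.trans ?_ hv)⟩
  have h3 := mfderiv_eq_zero_of_mem_tangentVectors hu hf hfN
  exact ((congrArg (fun y : W => y + (show W from mfderiv 𝓘(ℝ, E) 𝓘(ℝ, W) f x ξ)) h3).trans
    (zero_add _)).symm

variable {Θ : (X × (Fin k → ℝ)) ≃ₘ^∞⟮𝓘(ℝ, E).prod 𝓘(ℝ, Fin k → ℝ),
  𝓘(ℝ, E).prod 𝓘(ℝ, Fin k → ℝ)⟯ (X × (Fin k → ℝ))}

omit [IsManifold 𝓘(ℝ, E) ∞ X] [FiniteDimensional ℝ E'] in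
theorem exists_isTransverseDefiningFunction (hα : IsOrbitMotion (E := E) G α)
    (hΘ : ∀ q, Θ q = (F q, q.2)) (hM : IsSubmanifoldOfCodim (E := E) k M)
    {x₀ : X} {z₀ : Fin k → ℝ} (h₀ : (x₀, z₀) ∈ familyTotal F M)
    (htr : TransverseToOrbit (E := E) (E' := E') G (familyMember F M z₀) x₀) :
    ∃ Q : X × (Fin k → ℝ) → (Fin k → ℝ),
      IsTransverseDefiningFunction (E := E) α (familyMember F M) x₀ z₀ Q ∧
      ∀ᶠ q in 𝓝 (x₀, z₀), q ∈ familyTotal F M →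
        tangentVectors (𝓘(ℝ, E).prod 𝓘(ℝ, Fin k → ℝ)) (familyTotal F M) q =
          {v | (mfderiv (𝓘(ℝ, E).prod 𝓘(ℝ, Fin k → ℝ)) 𝓘(ℝ, Fin k → ℝ) Q q v : Fin k → ℝ) = 0} := by
  obtain ⟨Q, hQ, hQM, hQt, hQs⟩ := exists_definingFunction_familyTotal hΘ hM h₀
  have hQM' : ∀ᶠ q : X × (Fin k → ℝ) in 𝓝 (x₀, z₀), q.1 ∈ familyMember F M q.2 ↔ Q q = 0 :=
    hQM.mono fun q hq => mem_familyMember_iff.trans hq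
  refine ⟨Q, ⟨hQ, hQM', ?_⟩, hQt⟩
  refine htr.surjective_fderiv hα (mem_familyMember_iff.2 h₀) (f := fun x => Q (x, z₀)) ?_ ?_ hQs
  · exact (hQ.self_of_nhds.comp x₀ (f := fun x => (x, z₀))
      (contMDiffAt_id.prodMk contMDiffAt_const)).mdifferentiableAt (by simp)
  · have : Tendsto (fun x : X => (x, z₀)) (𝓝 x₀) (𝓝 (x₀, z₀)) := Continuous.tendsto (by fun_prop) _
    exact (this.eventually hQM').mono fun x hx => hx.1

theorem exists_orbitPreserving_family [T2Space X] [CompactSpace X]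
    (hα : IsOrbitMotion (E := E) G α) (hΘ : ∀ q, Θ q = (F q, q.2)) (hMc : IsCompact M)
    (hM : IsSubmanifoldOfCodim (E := E) k M) (hY : IsClosed Y)
    (hYG : ∀ g : G, ∀ y ∈ Y, g • y ∈ Y)
    (htr : ∀ z ∈ Icc a b, ∀ y ∈ Y,
      TransverseToOrbit (E := E) (E' := E') G (familyMember F M z) y)
    {z z' : Fin k → ℝ} (hz : z ∈ Icc a b) (hz' : z' ∈ Icc a b) :
    ∃ Φ : X ≃ₘ^∞⟮𝓘(ℝ, E), 𝓘(ℝ, E)⟯ X, OrbitPreserving G Φ ∧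
      Φ '' (familyMember F M z ∩ Y) = familyMember F M z' ∩ Y := by
  refine exists_orbitPreserving_of_isPreconnected (S := fun z => familyMember F M z ∩ Y)
    (convex_Icc a b).isPreconnected (fun z₀ hz₀ => ?_) hz hz'
  refine eventually_exists_orbitPreserving (N := familyMember F M) (W := Fin k → ℝ) hα.contMDiff
    hα.apply_zero hα.mem_orbit hYG isClosed_closure.isCompact fun p hp => ?_
  rw [hY.closure_eq] at hp
  by_cases h : (p, z₀) ∈ familyTotal F M
  · obtain ⟨Q, hQ, -⟩ := exists_isTransverseDefiningFunction hα hΘ hM h (htr z₀ hz₀ p hp)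
    exact Or.inr ⟨Q, hQ⟩
  · refine Or.inl ?_
    have := (isClosed_familyTotal hΘ hMc.isClosed).isOpen_compl.eventually_mem h
    exact this.mono fun q hq hq' => hq (mem_familyMember_iff.1 hq')

/-! ### Vector fields tangent to a family -/

/-- The motion of `X × ℝᵏ` that moves the first factor along the orbits and translates
the second. -/
def totalMotion (α : X × E' → X) (q : (X × (Fin k → ℝ)) × (E' × (Fin k → ℝ))) :
    X × (Fin k → ℝ) :=
  (α (q.1.1, q.2.1), q.1.2 + q.2.2)

omit [FiniteDimensional ℝ E] [IsManifold 𝓘(ℝ, E) ∞ X] [FiniteDimensional ℝ E'] in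
theorem IsOrbitMotion.contMDiff_totalMotion (hα : IsOrbitMotion (E := E) G α) :
    ContMDiff ((𝓘(ℝ, E).prod 𝓘(ℝ, Fin k → ℝ)).prod 𝓘(ℝ, E' × (Fin k → ℝ)))
      (𝓘(ℝ, E).prod 𝓘(ℝ, Fin k → ℝ)) ∞ (totalMotion (k := k) α) := by
  have h1 : ContMDiff 𝓘(ℝ, E' × (Fin k → ℝ)) 𝓘(ℝ, E') ∞ (Prod.fst : E' × (Fin k → ℝ) → E') :=
    contDiff_fst.contMDiff
  have h2 : ContMDiff 𝓘(ℝ, E' × (Fin k → ℝ)) 𝓘(ℝ, Fin k → ℝ) ∞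
      (Prod.snd : E' × (Fin k → ℝ) → (Fin k → ℝ)) := contDiff_snd.contMDiff
  exact (hα.contMDiff.comp (contMDiff_fst.fst.prodMk (h1.comp contMDiff_snd))).prodMk
    (contMDiff_fst.snd.add (h2.comp contMDiff_snd))

omit [FiniteDimensional ℝ E] [IsManifold 𝓘(ℝ, E) ∞ X] [FiniteDimensional ℝ E'] in
theorem IsOrbitMotion.totalMotion_zero (hα : IsOrbitMotion (E := E) G α) (q : X × (Fin k → ℝ)) :
    totalMotion α (q, 0) = q :=
  Prod.ext (hα.apply_zero q.1) (add_zero q.2)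

omit [FiniteDimensional ℝ E] [FiniteDimensional ℝ E'] in
/-- Near a point of transversality the direction `ζ` of parameters lifts smoothly to directions of
motions tangent to the level sets of the defining function: subtract from `(0, ζ)` the correction
in the space of directions spanned by `P`. -/
theorem exists_lift_direction (hα : IsOrbitMotion (E := E) G α)
    {N : (Fin k → ℝ) → Set X} {x₀ : X} {z₀ : Fin k → ℝ} {Q : X × (Fin k → ℝ) → (Fin k → ℝ)}
    (hQ : IsTransverseDefiningFunction (E := E) α N x₀ z₀ Q) (ζ : Fin k → ℝ) :
    ∃ φ : X × (Fin k → ℝ) → E' × (Fin k → ℝ),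
      (∀ᶠ q in 𝓝 (x₀, z₀),
        ContMDiffAt (𝓘(ℝ, E).prod 𝓘(ℝ, Fin k → ℝ)) 𝓘(ℝ, E' × (Fin k → ℝ)) ∞ φ q) ∧
      ∀ᶠ q in 𝓝 (x₀, z₀), (φ q).2 = ζ ∧
        fderiv ℝ (fun y => Q (totalMotion α (q, y))) 0 (φ q) = 0 := by
  obtain ⟨P, hP⟩ := hQ.exists_rightInverse hα.contMDiff hα.apply_zero
  let P' : (Fin k → ℝ) →L[ℝ] E' × (Fin k → ℝ) := (ContinuousLinearMap.inl ℝ E' (Fin k → ℝ)).comp P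
  let A : X × (Fin k → ℝ) → E' × (Fin k → ℝ) →L[ℝ] (Fin k → ℝ) :=
    fun q => fderiv ℝ (fun y => Q (totalMotion α (q, y))) 0
  have hA : ∀ᶠ q in 𝓝 (x₀, z₀), ContMDiffAt (𝓘(ℝ, E).prod 𝓘(ℝ, Fin k → ℝ))
      𝓘(ℝ, E' × (Fin k → ℝ) →L[ℝ] (Fin k → ℝ)) ∞ A q :=
    hQ.contMDiffAt.mono fun q hq =>
      contMDiffAt_fderiv_motion hα.contMDiff_totalMotion hα.totalMotion_zero hq
  let B : X × (Fin k → ℝ) → (Fin k → ℝ) →L[ℝ] (Fin k → ℝ) := fun q => (A q).comp P'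
  have hB : ∀ᶠ q in 𝓝 (x₀, z₀), ContMDiffAt (𝓘(ℝ, E).prod 𝓘(ℝ, Fin k → ℝ))
      𝓘(ℝ, (Fin k → ℝ) →L[ℝ] (Fin k → ℝ)) ∞ B q :=
    hA.mono fun q hq => hq.clm_comp contMDiffAt_const
  have hB0 : B (x₀, z₀) = (ContinuousLinearEquiv.refl ℝ (Fin k → ℝ) : _ →L[ℝ] _) := by
    have hd : DifferentiableAt ℝ (fun y => Q (totalMotion α ((x₀, z₀), y))) (P' 0) := by
      rw [map_zero]
      refine (ContMDiffAt.comp (I' := 𝓘(ℝ, E).prod 𝓘(ℝ, Fin k → ℝ)) (0 : E' × (Fin k → ℝ)) ?_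
        (contMDiff_slice hα.contMDiff_totalMotion (x₀, z₀) 0)).contDiffAt.differentiableAt (by simp)
      rw [hα.totalMotion_zero]
      exact hQ.contMDiffAt.self_of_nhds
    have h1 := fderiv_comp (0 : Fin k → ℝ) hd P'.differentiableAt
    rw [P'.fderiv, map_zero] at h1
    refine h1.symm.trans (Eq.trans ?_ hP)
    congr 1
    funext c
    simp [totalMotion, P']
  have hinv : ∀ᶠ q in 𝓝 (x₀, z₀), B q ∈
      range ((↑) : ((Fin k → ℝ) ≃L[ℝ] (Fin k → ℝ)) → (Fin k → ℝ) →L[ℝ] (Fin k → ℝ)) := by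
    have h1 : Tendsto B (𝓝 (x₀, z₀)) (𝓝 (B (x₀, z₀))) := hB.self_of_nhds.continuousAt
    rw [hB0] at h1
    exact h1.eventually (ContinuousLinearEquiv.nhds _)
  refine ⟨fun q => (0, ζ) - P' (ContinuousLinearMap.inverse (B q) (A q (0, ζ))), ?_, ?_⟩
  · filter_upwards [hA, hB, hinv] with q hAq hBq hq
    obtain ⟨e, he⟩ := hq
    have h1 : ContMDiffAt (𝓘(ℝ, E).prod 𝓘(ℝ, Fin k → ℝ))
        𝓘(ℝ, (Fin k → ℝ) →L[ℝ] (Fin k → ℝ)) ∞ (fun q => ContinuousLinearMap.inverse (B q)) q := by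
      refine ContMDiffAt.comp (I' := 𝓘(ℝ, (Fin k → ℝ) →L[ℝ] (Fin k → ℝ))) q
        (g := ContinuousLinearMap.inverse) (ContDiffAt.contMDiffAt ?_) hBq
      rw [← he]
      exact contDiffAt_map_inverse e
    exact contMDiffAt_const.sub (P'.contMDiff.contMDiffAt.comp q
      (h1.clm_apply (hAq.clm_apply contMDiffAt_const)))
  · filter_upwards [hinv] with q hq
    obtain ⟨e, he⟩ := hq
    refine ⟨by simp [P'], ?_⟩
    change A q _ = 0
    rw [map_sub, sub_eq_zero]
    change A q (0, ζ) = B q _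
    rw [← he, ContinuousLinearMap.inverse_equiv]
    exact (e.apply_symm_apply _).symm

end FamilyIsotopy

section FamilyVectorField

variable {E : Type*} [NormedAddCommGroup E] [NormedSpace ℝ E] [FiniteDimensional ℝ E]
  {X : Type*} [TopologicalSpace X] [ChartedSpace E X] [IsManifold 𝓘(ℝ, E) ∞ X]
  {E' : Type*} [NormedAddCommGroup E'] [NormedSpace ℝ E'] [FiniteDimensional ℝ E']
  {G : Type*} [TopologicalSpace G] [ChartedSpace E' G] [Group G]
  [MulAction G X] {α : X × E' → X}
  {k : ℕ} {F : X × (Fin k → ℝ) → X} {M Y : Set X} {a b : Fin k → ℝ}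
  {Θ : (X × (Fin k → ℝ)) ≃ₘ^∞⟮𝓘(ℝ, E).prod 𝓘(ℝ, Fin k → ℝ),
    𝓘(ℝ, E).prod 𝓘(ℝ, Fin k → ℝ)⟯ (X × (Fin k → ℝ))}

omit [FiniteDimensional ℝ E'] in
/-- A vector field tangent to the total space and to the orbits that lifts the direction `ζ` in the
space of parameters. The local lifts are glued by
a partition of unity, together with the zero field away from the compact set where the lifting
condition is imposed. -/
theorem exists_vectorField_family [T2Space X] [CompactSpace X]
    (hα : IsOrbitMotion (E := E) G α) (hΘ : ∀ q, Θ q = (F q, q.2)) (hMc : IsCompact M)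
    (hM : IsSubmanifoldOfCodim (E := E) k M) (hY : IsClosed Y)
    (htr : ∀ z ∈ Icc a b, ∀ y ∈ Y,
      TransverseToOrbit (E := E) (E' := E') G (familyMember F M z) y) (ζ : Fin k → ℝ) :
    ∃ v : ∀ p : X × (Fin k → ℝ), TangentSpace (𝓘(ℝ, E).prod 𝓘(ℝ, Fin k → ℝ)) p,
      IsSmoothVectorField (𝓘(ℝ, E).prod 𝓘(ℝ, Fin k → ℝ)) v ∧
      HasCompactSupportField (𝓘(ℝ, E).prod 𝓘(ℝ, Fin k → ℝ)) v ∧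
      (∀ p ∈ familyTotal F M,
        v p ∈ tangentVectors (𝓘(ℝ, E).prod 𝓘(ℝ, Fin k → ℝ)) (familyTotal F M) p) ∧
      (∀ p : X × (Fin k → ℝ),
        mfderiv (𝓘(ℝ, E).prod 𝓘(ℝ, Fin k → ℝ)) 𝓘(ℝ, E) Prod.fst p (v p) ∈
          orbitTangent (E' := E') G p.1) ∧
      (∀ j, ∀ p ∈ familyTotal F M ∩ Y ×ˢ Icc a b,
        lieDerivFun (𝓘(ℝ, E).prod 𝓘(ℝ, Fin k → ℝ)) v (fun q => q.2 j) p = ζ j) := by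
  have hβ := hα.contMDiff_totalMotion (k := k)
  have hβ0 := hα.totalMotion_zero (k := k)
  set K : Set (X × (Fin k → ℝ)) := familyTotal F M ∩ Y ×ˢ Icc a b with hK
  have hKc : IsCompact K :=
    (hY.isCompact.prod isCompact_Icc).inter_left (isClosed_familyTotal hΘ hMc.isClosed)
  have : LocallyCompactSpace X := ChartedSpace.locallyCompactSpace E X
  obtain ⟨K', hK', hKK'⟩ := exists_compact_superset hKc
  -- the tangent spaces of the total space are linear subspaces
  have hker : ∀ p ∈ familyTotal F M, ∃ L : E × (Fin k → ℝ) →L[ℝ] (Fin k → ℝ),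
      tangentVectors (𝓘(ℝ, E).prod 𝓘(ℝ, Fin k → ℝ)) (familyTotal F M) p =
        {v | L v = 0} := by
    rintro ⟨x, z⟩ hp
    obtain ⟨Q, -, -, hQt, -⟩ := exists_definingFunction_familyTotal hΘ hM hp
    exact ⟨_, hQt.self_of_nhds hp⟩
  let D : ∀ p : X × (Fin k → ℝ), E' × (Fin k → ℝ) →L[ℝ] E × (Fin k → ℝ) := fun p =>
    mfderiv 𝓘(ℝ, E' × (Fin k → ℝ)) (𝓘(ℝ, E).prod 𝓘(ℝ, Fin k → ℝ))
      (fun y => totalMotion α (p, y)) 0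
  let t : X × (Fin k → ℝ) → Set (E' × (Fin k → ℝ)) := fun p => {y |
    (p ∈ familyTotal F M →
      D p y ∈ tangentVectors (𝓘(ℝ, E).prod 𝓘(ℝ, Fin k → ℝ)) (familyTotal F M) p) ∧
    (p ∈ K → y.2 = ζ) ∧ (p ∉ K' → y = 0)}
  obtain ⟨φ, hφ⟩ := exists_contMDiffMap_forall_mem_convex_of_local
    (𝓘(ℝ, E).prod 𝓘(ℝ, Fin k → ℝ)) (n := ⊤) (t := t) (by
      intro p y hy y' hy' r s _ _ hrs
      refine ⟨fun hp => ?_, fun hp => ?_, fun hp => ?_⟩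
      · obtain ⟨L, hL⟩ := hker p hp
        have h1 := hy.1 hp
        have h2 := hy'.1 hp
        rw [hL] at h1 h2 ⊢
        have h1' : L (D p y) = 0 := h1
        have h2' : L (D p y') = 0 := h2
        change L (D p (r • y + s • y')) = 0
        rw [map_add, map_smul, map_smul, map_add, map_smul, map_smul, h1', h2', smul_zero,
          smul_zero, add_zero]
      · rw [Prod.snd_add, Prod.smul_snd, Prod.smul_snd, hy.2.1 hp, hy'.2.1 hp, ← add_smul, hrs,
          one_smul]
      · rw [hy.2.2 hp, hy'.2.2 hp, smul_zero, smul_zero, add_zero]) (by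
      intro p
      by_cases hp : p ∈ K
      · obtain ⟨x₀, z₀⟩ := p
        obtain ⟨Q, hQ, hQt⟩ := exists_isTransverseDefiningFunction hα hΘ hM hp.1
          (htr z₀ hp.2.2 x₀ hp.2.1)
        obtain ⟨φ, hφ, hφQ⟩ := exists_lift_direction hα hQ ζ
        refine ⟨_, hφ.and (hφQ.and (hQt.and (hQ.contMDiffAt.and
          (mem_interior_iff_mem_nhds.1 (hKK' hp))))), φ,
          fun q hq => hq.1.contMDiffWithinAt, fun q hq => ?_⟩
        obtain ⟨-, ⟨h1, h2⟩, h3, h4, h5⟩ := hq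
        refine ⟨fun hqM => ?_, fun _ => h1, fun h => absurd h5 h⟩
        rw [h3 hqM]
        refine (mfderiv_motionField hβ hβ0 φ (h4.mdifferentiableAt (by simp))).trans ?_
        rw [mfderiv_eq_fderiv]
        exact h2
      · refine ⟨_, hKc.isClosed.isOpen_compl.mem_nhds hp, fun _ => 0, contMDiffOn_const,
          fun q hq => ⟨fun hqM => ?_, fun h => absurd h hq, fun _ => rfl⟩⟩
        obtain ⟨L, hL⟩ := hker q hqM
        rw [hL]
        change L (D q 0) = 0
        rw [map_zero, map_zero])
  refine ⟨motionField (𝓘(ℝ, E).prod 𝓘(ℝ, Fin k → ℝ)) (totalMotion α) φ,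
    isSmoothVectorField_motionField hβ hβ0 φ.contMDiff, ?_, fun p hp => (hφ p).1 hp,
    fun p => ?_, fun j p hp => ?_⟩
  · refine hK'.of_isClosed_subset isClosed_closure (closure_minimal (fun x hx => ?_) hK'.isClosed)
    by_contra hxK
    exact hx (motionField_eq_zero ((hφ x).2.2 hxK))
  · refine (hα.mem_orbitTangent_iff p.1 _).2 ⟨(φ p).1, ?_⟩
    have h1 := mfderiv_motionField hβ hβ0 φ
      (mdifferentiableAt_fst (I := 𝓘(ℝ, E)) (I' := 𝓘(ℝ, Fin k → ℝ)) (x := p))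
    refine Eq.trans ?_ h1.symm
    have h2 := mfderiv_comp (I := 𝓘(ℝ, E' × (Fin k → ℝ))) (I' := 𝓘(ℝ, E')) (I'' := 𝓘(ℝ, E))
      (0 : E' × (Fin k → ℝ)) (g := fun w => α (p.1, w)) (f := Prod.fst)
      ((contMDiff_slice hα.contMDiff p.1).mdifferentiable (by simp) _)
      (contDiff_fst.contMDiff.mdifferentiable (n := ∞) (by simp) _)
    rw [mfderiv_eq_fderiv, fderiv_fst] at h2
    exact (congrArg (fun L : E' × (Fin k → ℝ) →L[ℝ] E => L (φ p)) h2).symm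
  · let ℓ : E' × (Fin k → ℝ) →L[ℝ] ℝ :=
      (ContinuousLinearMap.proj j).comp (ContinuousLinearMap.snd ℝ E' (Fin k → ℝ))
    have hj : ContMDiff (𝓘(ℝ, E).prod 𝓘(ℝ, Fin k → ℝ)) 𝓘(ℝ, ℝ) ∞
        (fun q : X × (Fin k → ℝ) => q.2 j) :=
      (ContinuousLinearMap.proj (R := ℝ) (φ := fun _ : Fin k => ℝ) j).contMDiff.comp contMDiff_snd
    refine (mfderiv_motionField hβ hβ0 φ (hj.mdifferentiable (by simp) p)).trans ?_
    rw [mfderiv_eq_fderiv]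
    have h1 : (fun y : E' × (Fin k → ℝ) => (totalMotion α (p, y)).2 j) = fun y => p.2 j + ℓ y := rfl
    rw [h1, fderiv_const_add, ℓ.fderiv, ← (hφ p).2.1 hp]
    rfl

end FamilyVectorField

theorem mainTheorem6
    -- `X` is a smooth manifold without boundary
    {E : Type*} [NormedAddCommGroup E] [NormedSpace ℝ E] [FiniteDimensional ℝ E]
    {X : Type*} [TopologicalSpace X] [ChartedSpace E X] [IsManifold 𝓘(ℝ, E) ∞ X]
    [T2Space X] [SecondCountableTopology X]
    -- `G` is a Lie group acting smoothly on `X`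
    {E' : Type*} [NormedAddCommGroup E'] [NormedSpace ℝ E'] [FiniteDimensional ℝ E']
    {G : Type*} [TopologicalSpace G] [ChartedSpace E' G] [Group G] [LieGroup 𝓘(ℝ, E') ∞ G]
    [MulAction G X] [ContMDiffSMul 𝓘(ℝ, E') 𝓘(ℝ, E) ∞ G X] :
    -- the isotopy lemma for level sets of a function
    (∀ (Y : Set X) (f : X → ℝ) (a b : ℝ),
      (∀ g : G, ∀ y ∈ Y, g • y ∈ Y) → IsCompact (closure Y) →
      ContMDiff 𝓘(ℝ, E) 𝓘(ℝ, ℝ) ∞ f →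
      (∀ c ∈ Set.Icc a b, ∀ y ∈ closure Y, LevelSetTransverseToOrbit (E := E) (E' := E') G f c y) →
      (∃ v : ∀ x : X, TangentSpace 𝓘(ℝ, E) x,
        IsSmoothVectorField 𝓘(ℝ, E) v ∧ HasCompactSupportField 𝓘(ℝ, E) v ∧
        (∀ y ∈ Y, v y ∈ orbitTangent (E' := E') G y) ∧
        (∀ y ∈ Y, f y ∈ Set.Icc a b → lieDerivFun 𝓘(ℝ, E) v f y = 1)) ∧
      (∀ c₁ ∈ Set.Icc a b, ∀ c₂ ∈ Set.Icc a b, ∃ Φ : X ≃ₘ^∞⟮𝓘(ℝ, E), 𝓘(ℝ, E)⟯ X,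
        OrbitPreserving G Φ ∧ Φ '' (f ⁻¹' {c₁} ∩ Y) = f ⁻¹' {c₂} ∩ Y)) ∧
    -- the main theorem for families of submanifolds of a compact manifold
    (CompactSpace X →
      ∀ (k : ℕ) (F : X × (Fin k → ℝ) → X) (M Y : Set X) (a b : Fin k → ℝ),
      ContMDiff (𝓘(ℝ, E).prod 𝓘(ℝ, Fin k → ℝ)) 𝓘(ℝ, E) ∞ F →
      (∀ z : Fin k → ℝ, ∃ φ : X ≃ₘ^∞⟮𝓘(ℝ, E), 𝓘(ℝ, E)⟯ X, ∀ x, φ x = F (x, z)) →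
      IsCompact M → IsSubmanifoldOfCodim (E := E) k M →
      IsClosed Y → (∀ g : G, ∀ y ∈ Y, g • y ∈ Y) →
      (∀ z ∈ Set.Icc a b, ∀ y ∈ Y,
        TransverseToOrbit (E := E) (E' := E') G (familyMember F M z) y) →
      (∃ v : Fin k → ∀ p : X × (Fin k → ℝ), TangentSpace (𝓘(ℝ, E).prod 𝓘(ℝ, Fin k → ℝ)) p,
        (∀ i, IsSmoothVectorField (𝓘(ℝ, E).prod 𝓘(ℝ, Fin k → ℝ)) (v i)) ∧
        (∀ i, HasCompactSupportField (𝓘(ℝ, E).prod 𝓘(ℝ, Fin k → ℝ)) (v i)) ∧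
        (∀ i, ∀ p ∈ familyTotal F M,
          v i p ∈ tangentVectors (𝓘(ℝ, E).prod 𝓘(ℝ, Fin k → ℝ)) (familyTotal F M) p) ∧
        (∀ i, ∀ p : X × (Fin k → ℝ), p.2 ∈ Set.Icc a b →
          mfderiv (𝓘(ℝ, E).prod 𝓘(ℝ, Fin k → ℝ)) 𝓘(ℝ, E) Prod.fst p (v i p) ∈
            orbitTangent (E' := E') G p.1) ∧
        (∀ i j, ∀ p ∈ familyTotal F M ∩ Y ×ˢ Set.Icc a b,
          lieDerivFun (𝓘(ℝ, E).prod 𝓘(ℝ, Fin k → ℝ)) (v i) (fun q => q.2 j) p =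
            if i = j then 1 else 0)) ∧
      (∀ z ∈ Set.Icc a b, ∀ z' ∈ Set.Icc a b, ∃ Φ : X ≃ₘ^∞⟮𝓘(ℝ, E), 𝓘(ℝ, E)⟯ X,
        OrbitPreserving G Φ ∧
          Φ '' (familyMember F M z ∩ Y) = familyMember F M z' ∩ Y)) := by
  obtain ⟨α, hα⟩ := exists_isOrbitMotion (E := E) (X := X) (E' := E') (G := G)
  refine ⟨fun Y f a b hYG hY hf htr => ⟨exists_vectorField_levelSets hα hY hf htr,
    fun c₁ hc₁ c₂ hc₂ => exists_orbitPreserving_levelSets hα hYG hY hf htr hc₁ hc₂⟩, ?_⟩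
  intro _ k F M Y a b hF hFz hMc hM hY hYG htr
  obtain ⟨Θ, hΘ⟩ := exists_totalDiffeomorph hF hFz
  choose v hv1 hv2 hv3 hv4 hv5 using fun i : Fin k =>
    exists_vectorField_family hα hΘ hMc hM hY htr (Pi.single i 1)
  refine ⟨⟨v, hv1, hv2, hv3, fun i p _ => hv4 i p, fun i j p hp => ?_⟩,
    fun z hz z' hz' => exists_orbitPreserving_family hα hΘ hMc hM hY hYG htr hz hz'⟩
  rw [hv5 i j p hp, Pi.single_apply]
  simp only [eq_comm]
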